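/- All graphs are finite and simple. In a graph $G$, a leaf is a vertex of degree $1$ and a support vertex is a vertex adjacent to a leaf. A set $D\subseteq V(G)$ is a disjunctive dominating set if every vertex not in $D$ is adjacent to a vertex of $D$ or has at least two vertices of $D$ at distance exactly $2$ from it; $\gamma_2^d(G)$ is the minimum cardinality of such a set. A labeling $S$ of a tree $T$ assigns to each vertex $v$ a status $\mathrm{sta}(v)\in\{A,B,C,D\}$. Let $\mathscr T_2$ be the smallest family of labeled trees $(T,S)$ (up to isomorphism) that contains the path $P_4$ whose two leaves have status $C$ and whose two other vertices have status $A$, and that is closed under the operations $\mathscr O_2,\mathscr O_3,\mathscr O_4$ below. The basic path of a member of $\mathscr T_2$ is the copy in it of the initial $P_4$ from which it was built. If $v\,v_1v_2\,u$ is an induced path of $T$ with $\mathrm{sta}(v)=A$, $\mathrm{sta}(v_1)=C$, $\mathrm{sta}(v_2)=D$, $\mathrm{sta}(u)=B$, then $v$ is called a corresponding vertex of $u$; if moreover $v$ is not a support vertex and is not on the basic path, then $u$ is called a corresponding vertex of $v$. - $\mathscr O_2$: let $v$ be a vertex of status $B$ that has a corresponding vertex of degree two; add a new path $u_1u_2$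 and the edge $u_1v$, with $\mathrm{sta}(u_1)=A$, $\mathrm{sta}(u_2)=C$. - $\mathscr O_3$: let $v$ be a vertex of status $C$ and degree one; add a new path $u_1u_2u_3u_4$ and the edge $u_1v$, with $\mathrm{sta}(u_1)=D$, $\mathrm{sta}(u_2)=B$, $\mathrm{sta}(u_3)=A$, $\mathrm{sta}(u_4)=C$. - $\mathscr O_4$: let $v$ be a vertex of status $A$ that is not on the basic path and has a corresponding vertex of degree two; add a new path $u_1u_2$ and the edge $u_1v$, with $\mathrm{sta}(u_1)=A$, $\mathrm{sta}(u_2)=C$. **Theorem.** Let $T$ be a tree with $n\ge 2$ vertices, $l$ leaves and $s$ support vertices. Then $$\gamma_2^d(T)\le \frac{n+l+s}{4},$$ with equality if and only if $(T,S)\in\mathscr T_2$ for some labeling $S$ of $T$. -/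

import Mathlib

namespace DisjDom

universe u

/-- The four labels a vertex of a labeled tree can carry. A labeling of a tree on `V`, i.e. a weak
partition `(S_A, S_B, S_C, S_D)` of `V`, is a function `V → Status`. -/
inductive Status : Type
  | A | B | C | D

/-- The number of neighbours of `v`. -/
noncomputable def deg {V : Type u} (G : SimpleGraph V) (v : V) : ℕ :=
  (G.neighborSet v).ncard

/-- A leaf is a vertex of degree one. -/
def IsLeaf {V : Type u} (G : SimpleGraph V) (v : V) : Prop :=
  deg G v = 1

/-- A support vertex is a vertex adjacent to a leaf. -/
def IsSupport {V : Type u} (G : SimpleGraph V) (v : V) : Prop :=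
  ∃ w, G.Adj v w ∧ IsLeaf G w

/-- `l(G)`. -/
noncomputable def numLeaves {V : Type u} (G : SimpleGraph V) : ℕ :=
  {v | IsLeaf G v}.ncard

/-- `s(G)`. -/
noncomputable def numSupports {V : Type u} (G : SimpleGraph V) : ℕ :=
  {v | IsSupport G v}.ncard

/-- `D` is a disjunctive dominating set: every vertex outside `D` is adjacent to a vertex of `D` or
has at least two vertices of `D` at distance two from it. -/
def IsDisjDominating {V : Type u} (G : SimpleGraph V) (D : Finset V) : Prop :=
  ∀ v, v ∉ D → (∃ w ∈ D, G.Adj v w) ∨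
    ∃ a ∈ D, ∃ b ∈ D, a ≠ b ∧ G.dist v a = 2 ∧ G.dist v b = 2

/-- The disjunctive domination number; on a finite vertex set the set of cardinalities is nonempty,
as the set of all vertices is disjunctive dominating. -/
noncomputable def disjDomNumber {V : Type u} (G : SimpleGraph V) : ℕ :=
  sInf {k | ∃ D : Finset V, IsDisjDominating G D ∧ D.card = k}

/-- Add to `G` a new path with `k` vertices `u₀ u₁ ⋯ u_{k-1}` and the edge `u₀v`. -/
def attachPath {V : Type u} (G : SimpleGraph V) (v : V) (k : ℕ) : SimpleGraph (V ⊕ Fin k) where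
  Adj
    | .inl a, .inl b => G.Adj a b
    | .inr i, .inr j => (SimpleGraph.pathGraph k).Adj i j
    | .inl a, .inr i => a = v ∧ i.val = 0
    | .inr i, .inl a => a = v ∧ i.val = 0
  symm := ⟨by
    rintro (a | i) (b | j) h
    · exact G.adj_symm h
    · exact h
    · exact h
    · exact (SimpleGraph.pathGraph k).adj_symm h⟩
  loopless := ⟨by
    rintro (a | i) h
    · exact G.irrefl h
    · exact (SimpleGraph.pathGraph k).irrefl h⟩

/-- `u` is a corresponding vertex of the vertex `v` of status `A`, where `P` is the vertex set of
the basic path: `v` is neither a support vertex nor on the basic path, and there is an induced path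
`v v₁ v₂ u` with statuses `A, C, D, B`. -/
def CorrespondsToA {V : Type u} (G : SimpleGraph V) (S : V → Status) (P : Set V) (v u : V) :
    Prop :=
  ¬ IsSupport G v ∧ v ∉ P ∧ S v = .A ∧
    ∃ f : SimpleGraph.pathGraph 4 ↪g G,
      f 0 = v ∧ f 3 = u ∧ S (f 1) = .C ∧ S (f 2) = .D ∧ S u = .B

/-- `v` is a corresponding vertex of the vertex `u` of status `B`: there is an induced path
`v v₁ v₂ u` with statuses `A, C, D, B`. -/
def CorrespondsToB {V : Type u} (G : SimpleGraph V) (S : V → Status) (u v : V) : Prop :=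
  S u = .B ∧
    ∃ f : SimpleGraph.pathGraph 4 ↪g G,
      f 0 = v ∧ f 3 = u ∧ S v = .A ∧ S (f 1) = .C ∧ S (f 2) = .D

/-- `Generated G S P`: the labeled graph `(G, S)` is obtained from the labeled path `P₄` with
statuses `C, A, A, C` by a finite sequence of the operations `op2`, `op3`, `op4`, and `P` is the
vertex set of the copy of that initial path (the basic path). Labeled graphs are taken up to
isomorphism. -/
inductive Generated :
    {V : Type u} → SimpleGraph V → (V → Status) → Set V → Prop
  | base {V : Type u} (G : SimpleGraph V) (e : SimpleGraph.pathGraph 4 ≃g G) :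
      Generated G (fun v => ![Status.C, .A, .A, .C] (e.symm v)) Set.univ
  | op2 {V : Type u} {G : SimpleGraph V} {S : V → Status} {P : Set V} (v : V) :
      Generated G S P → S v = .B → (∃ w, CorrespondsToB G S v w ∧ deg G w = 2) →
      Generated (attachPath G v 2) (Sum.elim S ![Status.A, .C]) (Sum.inl '' P)
  | op3 {V : Type u} {G : SimpleGraph V} {S : V → Status} {P : Set V} (v : V) :
      Generated G S P → S v = .C → deg G v = 1 →
      Generated (attachPath G v 4) (Sum.elim S ![Status.D, .B, .A, .C]) (Sum.inl '' P)
  | op4 {V : Type u} {G : SimpleGraph V} {S : V → Status} {P : Set V} (v : V) :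
      Generated G S P → v ∉ P → S v = .A → (∃ w, CorrespondsToA G S P v w ∧ deg G w = 2) →
      Generated (attachPath G v 2) (Sum.elim S ![Status.A, .C]) (Sum.inl '' P)
  | iso {V W : Type u} {G : SimpleGraph V} {H : SimpleGraph W} {S : V → Status} {P : Set V}
      (e : G ≃g H) :
      Generated G S P → Generated H (fun w => S (e.symm w)) (e '' P)

/-- Membership of the labeled graph `(G, S)` in the family `𝒯₂`. -/
def FamilyT2 {V : Type u} (G : SimpleGraph V) (S : V → Status) : Prop :=
  ∃ P : Set V, Generated G S P

end DisjDom

namespace DisjDom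

universe u w

/-! ### Disjunctive domination without distances -/

/-! With `weight` denoting n + l + s, the bound reads 4γ ≤ `weight`. The extremal trees split into
pieces worth exactly 4: an end joined to a leaf (2 vertices, 1 leaf, 1 support), or four vertices `e
c d e'` in a path with `c`, `d` of degree two. Distinct pieces are joined only through their ends.
So the number of pieces is `weight` / 4, and equality says that no dominating set beats one vertex
per piece.

The inequality comes from a minimal counterexample rooted at a leaf (`bound_step`). Cutting off
pendant paths lowers `weight` by at least 4 per vertex saved in the dominating set. This forces
everything below each vertex to be a path on at most five vertices, so the whole tree is a short
path. Almost all reductions are strict. Only two can keep equality: removing a pendant path on two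
vertices from a vertex with two other neighbours, and removing the last four vertices of a long
pendant path. Both transport a decomposition (`Pieces.attach_two`, `Pieces.attach_four`), and the
base path on four vertices has one. Hence `Bound` carries the existence of `Pieces` under equality.

Given a decomposition, root the tree in one piece. One end from each other piece dominates
everything outside the root piece (`Pieces.exists_nearly_dominating`), and also the root piece
unless one of its inner vertices sits next to an end with only one neighbour outside its piece. So
equality forces such a critical vertex in every piece (`Pieces.tight_of_eq`). Conversely, a critical
vertex forces an element of every dominating set into its piece, which gives equality
(`Tight.weight_le`).

It remains to identify tight trees with the family. The operations preserve tightness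
(`Generated.exists_tight`). A tight tree contains a suitable initial path, and a generated subtree
can be enlarged by an operation until it is everything (`Tight.exists_familyT2`). -/

/-- `v` is disjunctively dominated by the set `D`. -/
def Dominated {V : Type u} (G : SimpleGraph V) (D : Set V) (v : V) : Prop :=
  v ∈ D ∨ (∃ w ∈ D, G.Adj v w) ∨
    ∃ a ∈ D, ∃ b ∈ D, a ≠ b ∧ (∃ x, G.Adj v x ∧ G.Adj x a) ∧ ∃ y, G.Adj v y ∧ G.Adj y b

theorem dist_eq_two_of_common {V : Type u} {G : SimpleGraph V} {v x a : V} (hne : v ≠ a)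
    (hna : ¬ G.Adj v a) (hx : G.Adj v x) (hxa : G.Adj x a) : G.dist v a = 2 := by
  have h : G.edist v a = 2 :=
    SimpleGraph.edist_eq_two_iff.2 ⟨hne, hna, ⟨x, SimpleGraph.mem_commonNeighbors _ |>.2
      ⟨hx, hxa.symm⟩⟩⟩
  simp [SimpleGraph.dist, h]

theorem exists_common_of_dist_eq_two {V : Type u} {G : SimpleGraph V} {v a : V}
    (h : G.dist v a = 2) : ∃ x, G.Adj v x ∧ G.Adj x a := by
  have hr : G.Reachable v a := SimpleGraph.Reachable.of_dist_ne_zero (by omega)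
  have h2 : G.edist v a = 2 := by rw [← hr.coe_dist_eq_edist, h]; rfl
  obtain ⟨x, hx⟩ := (SimpleGraph.edist_eq_two_iff.1 h2).2.2
  rw [SimpleGraph.mem_commonNeighbors] at hx
  exact ⟨x, hx.1, hx.2.symm⟩

/-- A walk of length two joins equal or adjacent vertices or vertices at distance two. The first two
cases are absorbed by the other alternatives of `Dominated`, so distances can be dropped. -/
theorem isDisjDominating_iff {V : Type u} {G : SimpleGraph V} {D : Finset V} :
    IsDisjDominating G D ↔ ∀ v, Dominated G (D : Set V) v := by
  constructor
  · intro h v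
    by_cases hv : v ∈ D
    · exact Or.inl hv
    rcases h v hv with h | ⟨a, ha, b, hb, hab, h1, h2⟩
    · exact Or.inr (Or.inl h)
    · exact Or.inr (Or.inr ⟨a, ha, b, hb, hab, exists_common_of_dist_eq_two h1,
        exists_common_of_dist_eq_two h2⟩)
  · intro h v hv
    rcases h v with h | h | ⟨a, ha, b, hb, hab, ⟨x, hx, hxa⟩, y, hy, hyb⟩
    · exact absurd h hv
    · exact Or.inl h
    · by_cases h1 : G.Adj v a
      · exact Or.inl ⟨a, ha, h1⟩
      by_cases h2 : G.Adj v b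
      · exact Or.inl ⟨b, hb, h2⟩
      refine Or.inr ⟨a, ha, b, hb, hab, dist_eq_two_of_common ?_ h1 hx hxa,
        dist_eq_two_of_common ?_ h2 hy hyb⟩
      · rintro rfl; exact hv ha
      · rintro rfl; exact hv hb

theorem disjDomNumber_le {V : Type u} [Finite V] {G : SimpleGraph V} {D : Set V}
    (h : ∀ v, Dominated G D v) : disjDomNumber G ≤ D.ncard := by
  refine Nat.sInf_le ⟨D.toFinite.toFinset, isDisjDominating_iff.2 (by simpa using h), ?_⟩
  rw [Set.ncard_eq_toFinset_card D]

theorem exists_dominating {V : Type u} [Finite V] (G : SimpleGraph V) :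
    ∃ D : Set V, (∀ v, Dominated G D v) ∧ D.ncard = disjDomNumber G := by
  have hne : {k | ∃ D : Finset V, IsDisjDominating G D ∧ D.card = k}.Nonempty :=
    ⟨_, (Set.toFinite (Set.univ : Set V)).toFinset,
      isDisjDominating_iff.2 fun v => Or.inl (by simp), rfl⟩
  obtain ⟨D, hD, hc⟩ := Nat.sInf_mem hne
  exact ⟨D, isDisjDominating_iff.1 hD, by rw [Set.ncard_coe_finset]; exact hc⟩

/-- Injectivity and preservation of edges suffice, since `Dominated` never asks for a non-edge. -/
theorem Dominated.map {V W : Type u} {G : SimpleGraph V} {H : SimpleGraph W} (f : V → W)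
    (hinj : Function.Injective f) (hf : ∀ a b, G.Adj a b → H.Adj (f a) (f b)) {D : Set V}
    {D' : Set W} (hD : ∀ a ∈ D, f a ∈ D') {v : V} (h : Dominated G D v) :
    Dominated H D' (f v) := by
  rcases h with h | ⟨w, hw, h⟩ | ⟨a, ha, b, hb, hab, ⟨x, hx, hxa⟩, y, hy, hyb⟩
  · exact Or.inl (hD _ h)
  · exact Or.inr (Or.inl ⟨_, hD _ hw, hf _ _ h⟩)
  · exact Or.inr (Or.inr ⟨_, hD _ ha, _, hD _ hb, hinj.ne hab, ⟨_, hf _ _ hx, hf _ _ hxa⟩,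
      _, hf _ _ hy, hf _ _ hyb⟩)

/-! ### Leaves and degrees -/

theorem isLeaf_iff {V : Type u} {G : SimpleGraph V} {v : V} :
    IsLeaf G v ↔ ∃ w, G.Adj v w ∧ ∀ x, G.Adj v x → x = w := by
  unfold IsLeaf deg
  rw [Set.ncard_eq_one]
  constructor
  · rintro ⟨w, hw⟩
    refine ⟨w, ?_, fun x hx => ?_⟩
    · have : w ∈ G.neighborSet v := by rw [hw]; rfl
      exact this
    · have : x ∈ G.neighborSet v := hx
      rw [hw] at this
      exact this
  · rintro ⟨w, hw, h⟩
    exact ⟨w, Set.eq_singleton_iff_unique_mem.2 ⟨hw, h⟩⟩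

theorem deg_eq_two_iff {V : Type u} {G : SimpleGraph V} {v : V} :
    deg G v = 2 ↔ ∃ x y, x ≠ y ∧ ∀ z, G.Adj v z ↔ z = x ∨ z = y := by
  unfold deg
  rw [Set.ncard_eq_two]
  constructor
  · rintro ⟨x, y, hxy, h⟩
    refine ⟨x, y, hxy, fun z => ?_⟩
    rw [← SimpleGraph.mem_neighborSet, h]
    simp
  · rintro ⟨x, y, hxy, h⟩
    refine ⟨x, y, hxy, ?_⟩
    ext z
    simp [h]

/-- `v` has at least two neighbours. -/
def Branching {V : Type u} (G : SimpleGraph V) (v : V) : Prop :=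
  ∃ x y, x ≠ y ∧ G.Adj v x ∧ G.Adj v y

theorem Branching.not_isLeaf {V : Type u} {G : SimpleGraph V} {v : V} (h : Branching G v) :
    ¬ IsLeaf G v := by
  rw [isLeaf_iff]
  rintro ⟨w, -, hw⟩
  obtain ⟨x, y, hxy, hx, hy⟩ := h
  exact hxy ((hw x hx).trans (hw y hy).symm)

theorem exists_adj_of_tree {V : Type u} [Nontrivial V] {G : SimpleGraph V} (hG : G.IsTree)
    (v : V) : ∃ w, G.Adj v w :=
  hG.connected.preconnected.exists_adj_of_nontrivial v

theorem branching_or_isLeaf {V : Type u} [Nontrivial V] {G : SimpleGraph V} (hG : G.IsTree)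
    (v : V) : Branching G v ∨ IsLeaf G v := by
  obtain ⟨w, hw⟩ := exists_adj_of_tree hG v
  by_cases h : ∀ x, G.Adj v x → x = w
  · exact Or.inr (isLeaf_iff.2 ⟨w, hw, h⟩)
  · push Not at h
    obtain ⟨x, hx, hxw⟩ := h
    exact Or.inl ⟨x, w, hxw, hx, hw⟩

/-- The order plus the number of leaves plus the number of support vertices. -/
noncomputable def weight {V : Type u} (G : SimpleGraph V) : ℕ :=
  Nat.card V + numLeaves G + numSupports G

/-! ### Isomorphism invariance -/

theorem isLeaf_iso {V W : Type u} {G : SimpleGraph V} {H : SimpleGraph W} (e : G ≃g H) (v : V) :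
    IsLeaf H (e v) ↔ IsLeaf G v := by
  rw [isLeaf_iff, isLeaf_iff]
  constructor
  · rintro ⟨w, hw, h⟩
    refine ⟨e.symm w, ?_, fun x hx => ?_⟩
    · rw [← e.map_adj_iff]; simpa using hw
    · rw [← h (e x) (e.map_adj_iff.2 hx)]; simp
  · rintro ⟨w, hw, h⟩
    refine ⟨e w, e.map_adj_iff.2 hw, fun x hx => ?_⟩
    rw [← h (e.symm x) (by rw [← e.map_adj_iff]; simpa using hx)]; simp

theorem isSupport_iso {V W : Type u} {G : SimpleGraph V} {H : SimpleGraph W} (e : G ≃g H) (v : V) :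
    IsSupport H (e v) ↔ IsSupport G v := by
  constructor
  · rintro ⟨w, hw, h⟩
    refine ⟨e.symm w, ?_, ?_⟩
    · rw [← e.map_adj_iff]; simpa using hw
    · rw [← isLeaf_iso e]; simpa using h
  · rintro ⟨w, hw, h⟩
    exact ⟨e w, e.map_adj_iff.2 hw, (isLeaf_iso e w).2 h⟩

theorem weight_iso {V W : Type u} {G : SimpleGraph V} {H : SimpleGraph W} (e : G ≃g H) :
    weight H = weight G := by
  have h1 : {w | IsLeaf H w} = e '' {v | IsLeaf G v} := by
    ext w
    constructor
    · intro h
      exact ⟨e.symm w, by rw [Set.mem_ofPred_eq, ← isLeaf_iso e]; simpa using h, by simp⟩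
    · rintro ⟨v, hv, rfl⟩
      exact (isLeaf_iso e v).2 hv
  have h2 : {w | IsSupport H w} = e '' {v | IsSupport G v} := by
    ext w
    constructor
    · intro h
      exact ⟨e.symm w, by rw [Set.mem_ofPred_eq, ← isSupport_iso e]; simpa using h, by simp⟩
    · rintro ⟨v, hv, rfl⟩
      exact (isSupport_iso e v).2 hv
  unfold weight numLeaves numSupports
  rw [h1, h2, Set.ncard_image_of_injective _ e.injective,
    Set.ncard_image_of_injective _ e.injective, Nat.card_congr e.toEquiv]

theorem disjDomNumber_iso_le {V W : Type u} [Finite V] [Finite W] {G : SimpleGraph V}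
    {H : SimpleGraph W} (e : G ≃g H) : disjDomNumber H ≤ disjDomNumber G := by
  obtain ⟨D, hD, hc⟩ := exists_dominating G
  rw [← hc, ← Set.ncard_image_of_injective D e.injective]
  refine disjDomNumber_le fun w => ?_
  have := (hD (e.symm w)).map (H := H) e e.injective (fun a b h => e.map_adj_iff.2 h)
    (D' := e '' D) (fun a ha => ⟨a, ha, rfl⟩)
  simpa using this

theorem disjDomNumber_iso {V W : Type u} [Finite V] [Finite W] {G : SimpleGraph V}
    {H : SimpleGraph W} (e : G ≃g H) : disjDomNumber H = disjDomNumber G :=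
  le_antisymm (disjDomNumber_iso_le e) (disjDomNumber_iso_le e.symm)

/-! ### Distances in trees -/

theorem exists_parent {V : Type u} {G : SimpleGraph V} (hG : G.Connected) (r : V) {v : V}
    (hv : v ≠ r) : ∃ p, G.Adj v p ∧ G.dist r v = G.dist r p + 1 := by
  obtain ⟨w, hw⟩ := hG.exists_walk_length_eq_dist v r
  cases w with
  | nil => exact absurd rfl hv
  | @cons _ p _ h q =>
    refine ⟨p, h, ?_⟩
    have h1 : G.dist p r ≤ q.length := SimpleGraph.dist_le q
    have h2 := hG.dist_triangle (u := v) (v := p) (w := r)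
    have h3 : G.dist v p = 1 := SimpleGraph.dist_eq_one_iff_adj.2 h
    rw [SimpleGraph.Walk.length_cons] at hw
    rw [SimpleGraph.dist_comm (u := r), SimpleGraph.dist_comm (u := r)]
    omega

/-- Shortest paths to `a` and `b` avoid `v`, so both extend to a path from `r` to `v`. That path is
unique, and its penultimate vertex is both `a` and `b`. -/
theorem parent_unique {V : Type u} {G : SimpleGraph V} (hG : G.IsTree) (r : V) {v a b : V}
    (ha : G.Adj v a) (hb : G.Adj v b) (hda : G.dist r v = G.dist r a + 1)
    (hdb : G.dist r v = G.dist r b + 1) : a = b := by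
  obtain ⟨p, hp, hpl⟩ := hG.connected.exists_path_of_dist r a
  obtain ⟨q, hq, hql⟩ := hG.connected.exists_path_of_dist r b
  classical
  have key : ∀ {c : V} (s : G.Walk r c), s.length = G.dist r c → G.dist r v = G.dist r c + 1 →
      v ∉ s.support := by
    intro c s hs hc hmem
    have h1 := SimpleGraph.dist_le (s.takeUntil v hmem)
    have h2 := s.length_takeUntil_le_length hmem
    omega
  have h1 := hp.concat (key p hpl hda) ha.symm
  have h2 := hq.concat (key q hql hdb) hb.symm
  have h3 := Subtype.mk.inj ((hG.isAcyclic.subsingleton_path _ _).elim ⟨_, h1⟩ ⟨_, h2⟩)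
  have h4 := congrArg SimpleGraph.Walk.penultimate h3
  simpa using h4

theorem dist_child {V : Type u} {G : SimpleGraph V} (hG : G.IsTree) (r : V) {v p x : V}
    (hp : G.Adj v p) (hdp : G.dist r v = G.dist r p + 1) (hx : G.Adj v x) (hne : x ≠ p) :
    G.dist r x = G.dist r v + 1 := by
  rcases hG.dist_eq_dist_add_one_of_adj r hx with h | h
  · exact absurd (parent_unique hG r hx hp h hdp) hne
  · exact h

/-! ### Decompositions into pieces

A decomposition of a graph into pieces `{e, c}` with `c` a leaf, and `{e, c, d, e'}` with `c` and
`d` of degree two, is determined by the set `E` of the ends `e`, `e'` of its pieces. -/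

/-- `E` is the set of ends of a decomposition of `G` into pieces. -/
structure Pieces {V : Type u} (G : SimpleGraph V) (E : Set V) : Prop where
  exists_inner : ∀ e ∈ E, ∃ c, c ∉ E ∧ G.Adj e c
  inner_unique : ∀ e ∈ E, ∀ c c', c ∉ E → c' ∉ E → G.Adj e c → G.Adj e c' → c = c'
  exists_end : ∀ c, c ∉ E → ∃ e ∈ E, G.Adj c e
  end_unique : ∀ c, c ∉ E → ∀ e ∈ E, ∀ e' ∈ E, G.Adj c e → G.Adj c e' → e = e'
  link_unique : ∀ c d d', c ∉ E → d ∉ E → d' ∉ E → G.Adj c d → G.Adj c d' → d = d'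
  exists_adj_end : ∀ e ∈ E, ∃ x ∈ E, G.Adj e x

/-- The end `e` has at most one neighbour outside its piece. -/
def SmallEnd {V : Type u} (G : SimpleGraph V) (E : Set V) (e : V) : Prop :=
  ∀ x ∈ E, ∀ y ∈ E, G.Adj e x → G.Adj e y → x = y

/-- Every piece has a critical vertex: its leaf, or the inner vertex next to a small end. -/
structure Tight {V : Type u} (G : SimpleGraph V) (E : Set V) : Prop extends Pieces G E where
  small_of_leaf : ∀ e ∈ E, ∀ c, c ∉ E → G.Adj e c → (∀ d, d ∉ E → ¬ G.Adj c d) → SmallEnd G E e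
  small_of_link : ∀ e ∈ E, ∀ e' ∈ E, ∀ c d, c ∉ E → d ∉ E → G.Adj e c → G.Adj c d → G.Adj d e' →
    SmallEnd G E e ∨ SmallEnd G E e'

namespace Pieces

variable {V : Type u} {G : SimpleGraph V} {E : Set V}

/-- An end has an inner neighbour and, by `exists_adj_end`, an end neighbour, so it is never a leaf.
An inner vertex has one end and at most one link. -/
theorem isLeaf_iff (h : Pieces G E) {c : V} :
    IsLeaf G c ↔ c ∉ E ∧ ∀ d, d ∉ E → ¬ G.Adj c d := by
  constructor
  · intro hl
    obtain ⟨w, hw, hu⟩ := DisjDom.isLeaf_iff.1 hl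
    have hc : c ∉ E := by
      intro hc
      obtain ⟨x, hx, hcx⟩ := h.exists_inner c hc
      obtain ⟨y, hy, hcy⟩ := h.exists_adj_end c hc
      exact hx ((hu x hcx).trans (hu y hcy).symm ▸ hy)
    refine ⟨hc, fun d hd hcd => ?_⟩
    obtain ⟨e, he, hce⟩ := h.exists_end c hc
    exact hd ((hu d hcd).trans (hu e hce).symm ▸ he)
  · rintro ⟨hc, hd⟩
    obtain ⟨e, he, hce⟩ := h.exists_end c hc
    refine DisjDom.isLeaf_iff.2 ⟨e, hce, fun x hx => ?_⟩
    by_cases hxE : x ∈ E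
    · exact h.end_unique c hc x hxE e he hx hce
    · exact absurd hx (hd x hxE)

/-- Ends and inner vertices are perfectly matched by adjacency; `μ` is the matching involution. -/
theorem exists_mate (h : Pieces G E) : ∃ μ : V → V, ∀ v, G.Adj v (μ v) ∧ (μ v ∈ E ↔ v ∉ E) := by
  have : ∀ v, ∃ w, G.Adj v w ∧ (w ∈ E ↔ v ∉ E) := by
    intro v
    by_cases hv : v ∈ E
    · obtain ⟨c, hc, hvc⟩ := h.exists_inner v hv
      exact ⟨c, hvc, by tauto⟩
    · obtain ⟨e, he, hve⟩ := h.exists_end v hv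
      exact ⟨e, hve, by tauto⟩
  exact ⟨fun v => (this v).choose, fun v => (this v).choose_spec⟩

theorem mate_eq (h : Pieces G E) {μ : V → V} (hμ : ∀ v, G.Adj v (μ v) ∧ (μ v ∈ E ↔ v ∉ E))
    {v w : V} (hvw : G.Adj v w) (hE : w ∈ E ↔ v ∉ E) : w = μ v := by
  obtain ⟨h1, h2⟩ := hμ v
  by_cases hv : v ∈ E
  · exact h.inner_unique v hv w (μ v) (by tauto) (by tauto) hvw h1
  · exact h.end_unique v hv w (by tauto) (μ v) (by tauto) hvw h1

theorem mate_mate (h : Pieces G E) {μ : V → V} (hμ : ∀ v, G.Adj v (μ v) ∧ (μ v ∈ E ↔ v ∉ E))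
    (v : V) : μ (μ v) = v :=
  (h.mate_eq hμ (hμ v).1.symm (by have := (hμ v).2; tauto)).symm

theorem ncard_compl (h : Pieces G E) [Finite V] : (Eᶜ).ncard = E.ncard := by
  obtain ⟨μ, hμ⟩ := h.exists_mate
  have hinj : Function.Injective μ := Function.LeftInverse.injective (h.mate_mate hμ)
  have : Eᶜ = μ '' E := by
    ext v
    constructor
    · intro hv
      exact ⟨μ v, (hμ v).2.2 hv, h.mate_mate hμ v⟩
    · rintro ⟨w, hw, rfl⟩
      exact fun hc => (hμ w).2.1 hc hw
  rw [this, Set.ncard_image_of_injective _ hinj]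

theorem setOf_isSupport {μ : V → V}
    (hμ : ∀ v, G.Adj v (μ v) ∧ (μ v ∈ E ↔ v ∉ E)) :
    {v | IsSupport G v} = μ '' {v | IsLeaf G v} := by
  ext v
  constructor
  · rintro ⟨w, hw, hl⟩
    refine ⟨w, hl, ?_⟩
    obtain ⟨x, -, hx⟩ := DisjDom.isLeaf_iff.1 hl
    rw [hx _ hw.symm, hx _ (hμ w).1]
  · rintro ⟨w, hw, rfl⟩
    exact ⟨w, (hμ w).1.symm, hw⟩

/-- The matching gives n = 2|E|, and it carries leaves onto supports, so l = s. The value is four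
times the number of pieces. -/
theorem weight_eq (h : Pieces G E) [Finite V] :
    weight G = 2 * E.ncard + 2 * {v | IsLeaf G v}.ncard := by
  obtain ⟨μ, hμ⟩ := h.exists_mate
  have hinj : Function.Injective μ := Function.LeftInverse.injective (h.mate_mate hμ)
  have h1 := Set.ncard_add_ncard_compl E
  have h2 := h.ncard_compl
  unfold weight numLeaves numSupports
  rw [setOf_isSupport hμ, Set.ncard_image_of_injective _ hinj]
  omega

/-- Rooting a decomposed tree at an inner vertex `r`, the upper ends of all pieces but that of `r`
dominate everything outside the piece of `r`. -/
theorem exists_nearly_dominating (h : Pieces G E) [Finite V] (hG : G.IsTree) {r : V} (hr : r ∉ E) :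
    ∃ D : Set V, 4 * D.ncard + 4 ≤ weight G ∧
      (∀ v, v ≠ r → (v ∉ E → ¬ G.Adj v r) → Dominated G D v) ∧
      (∀ e ∈ E, G.Adj r e → ∀ x ∈ E, G.Adj e x → x ∈ D) ∧
      (∀ d, d ∉ E → G.Adj r d → ∀ e ∈ E, G.Adj d e → ∀ x ∈ E, G.Adj e x → x ∈ D) := by
  obtain ⟨μ, hμ⟩ := h.exists_mate
  have hμμ := h.mate_mate hμ
  have hEμ : ∀ {v}, v ∈ E → μ v ∉ E := fun {v} hv hc => (hμ v).2.1 hc hv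
  have hμE : ∀ {v}, v ∉ E → μ v ∈ E := fun {v} hv => (hμ v).2.2 hv
  have hadj : ∀ v, G.Adj v (μ v) := fun v => (hμ v).1
  let t : V → ℕ := G.dist r
  have hadjt : ∀ {a b}, G.Adj a b → t a = t b + 1 ∨ t b = t a + 1 :=
    fun {a b} hab => hG.dist_eq_dist_add_one_of_adj r hab
  have hpar : ∀ {v a b}, G.Adj v a → G.Adj v b → t v = t a + 1 → t v = t b + 1 → a = b :=
    fun {v a b} => parent_unique hG r
  have htr : t r = 0 := SimpleGraph.dist_self
  -- The upper ends. A piece avoiding `r` is entered from above through an end and has exactly one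
  -- of them; the piece of `r` has none.
  let D : Set V := {e | e ∈ E ∧ t (μ e) = t e + 1}
  have lower : ∀ {e}, e ∈ E → e ∉ D → t e = t (μ e) + 1 := by
    intro e he hD
    rcases hadjt (hadj e) with h1 | h1
    · exact h1
    · exact absurd ⟨he, h1⟩ hD
  have below : ∀ {e x}, e ∈ E → e ∉ D → x ∈ E → G.Adj e x → x ∈ D ∧ t x = t e + 1 := by
    intro e x he hD hx hex
    have h1 := lower he hD
    have h2 : t x = t e + 1 := by
      rcases hadjt hex with h2 | h2
      · exact absurd (hpar hex (hadj e) h2 h1) (fun hc => hEμ he (hc ▸ hx))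
      · exact h2
    refine ⟨⟨hx, ?_⟩, h2⟩
    rcases hadjt (hadj x) with h3 | h3
    · exact absurd (hpar hex.symm (hadj x) h2 h3) (fun hc => hEμ hx (hc ▸ he))
    · exact h3
  have root : μ r ∉ D := by
    rintro ⟨-, h1⟩
    rw [hμμ, htr] at h1
    omega
  have hchild : ∀ {v}, G.Adj r v → t v = 1 := fun {v} hv => by
    rcases hadjt hv with h1 | h1 <;> omega
  have root' : ∀ d, d ∉ E → G.Adj r d → μ d ∉ D := by
    rintro d hd hrd ⟨-, h1⟩
    rw [hμμ, hchild hrd] at h1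
    have h2 : t d = t (μ d) + 1 := by rw [hchild hrd]; omega
    have h3 : t d = t r + 1 := by rw [hchild hrd]; omega
    exact hr (hpar hrd.symm (hadj d) h3 h2 ▸ hμE hd)
  refine ⟨D, ?_, ?_, ?_, ?_⟩
  · -- the opposite of an upper end is the leaf or the lower end of its piece
    have hopp : ∀ e, ∃ x, e ∈ D → (IsLeaf G (μ e) ∧ x = μ e) ∨
        (x ∈ E ∧ x ∉ D ∧ G.Adj (μ e) (μ x)) := by
      intro e
      by_cases he : e ∈ D
      swap
      · exact ⟨e, fun hc => absurd hc he⟩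
      by_cases hl : IsLeaf G (μ e)
      · exact ⟨μ e, fun _ => Or.inl ⟨hl, rfl⟩⟩
      rw [h.isLeaf_iff] at hl
      push Not at hl
      obtain ⟨d, hd, hed⟩ := hl (hEμ he.1)
      refine ⟨μ d, fun _ => Or.inr ⟨hμE hd, ?_, by rwa [hμμ]⟩⟩
      rintro ⟨-, h1⟩
      rw [hμμ] at h1
      have h2 : t (μ e) = t e + 1 := he.2
      rcases hadjt hed with h3 | h3
      · exact hd (hpar hed (hadj (μ e)).symm.symm h3 (by rw [hμμ]; exact h2) ▸ (hμμ e).symm ▸ he.1)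
      · exact hEμ he.1 (hpar hed.symm (hadj d) h3 h1 ▸ hμE hd)
    choose g hg using hopp
    have hginj : Set.InjOn g D := by
      intro a ha b hb hab
      rcases hg a ha with ⟨h1, h2⟩ | ⟨h1, h2, h3⟩ <;> rcases hg b hb with ⟨h4, h5⟩ | ⟨h4, h5, h6⟩
      · rw [← hμμ a, ← hμμ b, ← h2, ← h5, hab]
      · exact absurd (hab ▸ h4) (h2 ▸ hEμ ha.1)
      · exact absurd (hab ▸ h1) (h5 ▸ hEμ hb.1)
      · rw [hab] at h3
        have := h.link_unique (μ (g b)) (μ a) (μ b) (hEμ h4) (hEμ ha.1) (hEμ hb.1) h3.symm h6.symm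
        rw [← hμμ a, ← hμμ b, this]
    let L : Set V := {v | IsLeaf G v}
    have hsub : g '' D ⊆ (E \ D) ∪ L := by
      rintro _ ⟨a, ha, rfl⟩
      rcases hg a ha with ⟨h1, h2⟩ | ⟨h1, h2, h3⟩
      · rw [h2]; exact Or.inr h1
      · exact Or.inl ⟨h1, h2⟩
    have hlE : ∀ v, IsLeaf G v → v ∉ E := fun v hv => (h.isLeaf_iff.1 hv).1
    have h1 : μ r ∉ g '' D := by
      rintro ⟨a, ha, hga⟩
      rcases hg a ha with ⟨h2, h3⟩ | ⟨h2, h3, h4⟩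
      · exact hEμ ha.1 (h3 ▸ hga ▸ hμE hr)
      · rw [hga, hμμ] at h4
        exact root' (μ a) (hEμ ha.1) h4.symm (by rwa [hμμ])
    -- The injection `g` misses two elements belonging to the piece of `r`: `μ r`, and either the
    -- leaf `r` or the far end. Hence |D| + 2 ≤ |E| - |D| + |L|, which is the 4 to spare.
    have h2 : ∃ q, q ≠ μ r ∧ q ∉ g '' D ∧ q ∈ (E \ D) ∪ L := by
      by_cases hl : IsLeaf G r
      · refine ⟨r, fun hc => hr (by rw [hc]; exact hμE hr), ?_, Or.inr hl⟩
        rintro ⟨a, ha, hga⟩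
        rcases hg a ha with ⟨h2, h3⟩ | ⟨h2, h3, h4⟩
        · apply root
          rwa [← hga, h3, hμμ]
        · exact hr (hga ▸ h2)
      · rw [h.isLeaf_iff] at hl
        push Not at hl
        obtain ⟨d, hd, hrd⟩ := hl hr
        refine ⟨μ d, ?_, ?_, Or.inl ⟨hμE hd, root' d hd hrd⟩⟩
        · intro hc
          exact hrd.ne (by rw [← hμμ r, ← hc, hμμ])
        · rintro ⟨a, ha, hga⟩
          rcases hg a ha with ⟨h2, h3⟩ | ⟨h2, h3, h4⟩
          · exact hEμ ha.1 (h3 ▸ hga ▸ hμE hd)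
          · rw [hga, hμμ] at h4
            have := h.link_unique d r (μ a) hd hr (hEμ ha.1) hrd.symm h4.symm
            apply root
            rwa [this, hμμ]
    obtain ⟨q, hqr, hq, hqm⟩ := h2
    have h3 : insert q (insert (μ r) (g '' D)) ⊆ (E \ D) ∪ L := by
      rintro x (rfl | rfl | hx)
      · exact hqm
      · exact Or.inl ⟨hμE hr, root⟩
      · exact hsub hx
    have h4 := Set.ncard_le_ncard h3
    rw [Set.ncard_insert_of_notMem (by rintro (hc | hc); exacts [hqr hc, hq hc]),
      Set.ncard_insert_of_notMem h1, hginj.ncard_image] at h4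
    have h5 := Set.ncard_union_le (E \ D) L
    have hDE : D ⊆ E := fun x hx => hx.1
    have h6 := Set.ncard_sdiff_add_ncard_of_subset hDE
    rw [h.weight_eq]
    change 4 * D.ncard + 4 ≤ 2 * E.ncard + 2 * L.ncard
    omega
  · intro v hvr hv
    by_cases hvE : v ∈ E
    · by_cases hvD : v ∈ D
      · exact Or.inl hvD
      · obtain ⟨x, hx, hvx⟩ := h.exists_adj_end v hvE
        exact Or.inr (Or.inl ⟨x, (below hvE hvD hx hvx).1, hvx⟩)
    · by_cases hvD : μ v ∈ D
      · exact Or.inr (Or.inl ⟨μ v, hvD, hadj v⟩)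
      -- Here the mate of `v` is a lower end. Then `v` sees two elements of `D` at distance two: `x`
      -- below through its mate, and the upper end `p` of its own piece above through the link `d`.
      obtain ⟨x, hx, hvx⟩ := h.exists_adj_end (μ v) (hμE hvE)
      obtain ⟨hxD, hxt⟩ := below (hμE hvE) hvD hx hvx
      have h1 := lower (hμE hvE) hvD
      rw [hμμ] at h1
      obtain ⟨d, hvd, hd⟩ := exists_parent hG.connected r hvr
      change t v = t d + 1 at hd
      have hdE : d ∉ E := by
        intro hdE
        have := h.mate_eq hμ hvd (by tauto)
        rw [this] at hd
        omega
      have hdr : d ≠ r := fun hc => hv hvE (hc ▸ hvd)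
      obtain ⟨p, hdp, hp⟩ := exists_parent hG.connected r hdr
      change t d = t p + 1 at hp
      have hpE : p ∈ E := by
        by_contra hpE
        have := h.link_unique d v p hdE hvE hpE hvd.symm hdp
        rw [this] at hd
        omega
      have hpd := h.mate_eq hμ hdp (by tauto)
      have hpD : p ∈ D := ⟨hpE, by rw [hpd, hμμ, ← hpd]; exact hp⟩
      refine Or.inr (Or.inr ⟨p, hpD, x, hxD, ?_, ⟨d, hvd, hdp⟩, μ v, hadj v, hvx⟩)
      rintro rfl
      omega
  · intro e he hre x hx hex
    have : e = μ r := h.mate_eq hμ hre (by tauto)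
    exact (below he (this ▸ root) hx hex).1
  · intro d hd hrd e he hde x hx hex
    have : e = μ d := h.mate_eq hμ hde (by tauto)
    exact (below he (this ▸ root' d hd hrd) hx hex).1

/-- If a decomposed tree attains the bound, then every piece has a critical vertex. -/
theorem tight_of_eq (h : Pieces G E) [Finite V] (hG : G.IsTree)
    (heq : 4 * disjDomNumber G = weight G) : Tight G E := by
  have dom : ∀ {D : Set V}, (∀ v, Dominated G D v) → 4 * D.ncard + 4 ≤ weight G → False := by
    intro D hD hc
    have := disjDomNumber_le hD
    omega
  refine ⟨h, ?_, ?_⟩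
  · intro e he c hc hec hleaf
    by_contra hs
    unfold SmallEnd at hs
    push Not at hs
    obtain ⟨x, hx, y, hy, hex, hey, hxy⟩ := hs
    obtain ⟨D, hcard, hdom, h1, -⟩ := h.exists_nearly_dominating hG hc
    refine dom (D := D) (fun v => ?_) hcard
    -- The only vertex left to dominate is `c`; it reaches the two ends `x`, `y` of `D` in two steps
    -- through `e`.
    by_cases hv : v = c
    · subst hv
      exact Or.inr (Or.inr ⟨x, h1 e he hec.symm x hx hex, y, h1 e he hec.symm y hy hey, hxy,
        ⟨e, hec.symm, hex⟩, e, hec.symm, hey⟩)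
    · exact hdom v hv fun hvE hvc => hleaf v hvE hvc.symm
  · intro e he e' he' c d hc hd hec hcd hde'
    by_contra hs
    unfold SmallEnd at hs
    push Not at hs
    obtain ⟨⟨x, hx, y, hy, hex, hey, hxy⟩, x', hx', y', hy', hex', hey', hxy'⟩ := hs
    obtain ⟨D, hcard, hdom, h1, h2⟩ := h.exists_nearly_dominating hG hc
    refine dom (D := D) (fun v => ?_) hcard
    by_cases hv : v = c
    · subst hv
      exact Or.inr (Or.inr ⟨x, h1 e he hec.symm x hx hex, y, h1 e he hec.symm y hy hey, hxy,
        ⟨e, hec.symm, hex⟩, e, hec.symm, hey⟩)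
    by_cases hv' : v = d
    · subst hv'
      exact Or.inr (Or.inr ⟨x', h2 v hd hcd e' he' hde' x' hx' hex', y',
        h2 v hd hcd e' he' hde' y' hy' hey', hxy', ⟨e', hde', hex'⟩, e', hde', hey'⟩)
    exact hdom v hv fun hvE hvc => hv' (h.link_unique c v d hc hvE hd hvc.symm hcd)

end Pieces

/-- Every piece of a tight decomposition meets every dominating set. -/
theorem Tight.weight_le {V : Type u} [Finite V] {G : SimpleGraph V} {E : Set V} (h : Tight G E)
    {D : Set V} (hD : ∀ v, Dominated G D v) : weight G ≤ 4 * D.ncard := by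
  classical
  have hP := h.toPieces
  obtain ⟨μ, hμ⟩ := hP.exists_mate
  have hμμ := hP.mate_mate hμ
  have hEμ : ∀ {v}, v ∈ E → μ v ∉ E := fun {v} hv hc => (hμ v).2.1 hc hv
  have hμE : ∀ {v}, v ∉ E → μ v ∈ E := fun {v} hv => (hμ v).2.2 hv
  have hadj : ∀ v, G.Adj v (μ v) := fun v => (hμ v).1
  -- the inner vertex next to a small end forces an element of `D` in its piece
  have crit : ∀ c, c ∉ E → SmallEnd G E (μ c) →
      c ∈ D ∨ μ c ∈ D ∨ ∃ d, d ∉ E ∧ G.Adj c d ∧ (d ∈ D ∨ μ d ∈ D) := by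
    intro c hc hs
    -- Two steps from `c` lead into its own piece or to an end next to `μ c`. A small end has only
    -- one such neighbour, so two distinct elements of `D` cannot both lie outside the piece.
    have hstep : ∀ a x, a ∈ D → G.Adj c x → G.Adj x a → (a ∈ E ∧ G.Adj (μ c) a) ∨
        (c ∈ D ∨ μ c ∈ D ∨ ∃ d, d ∉ E ∧ G.Adj c d ∧ (d ∈ D ∨ μ d ∈ D)) := by
      intro a x ha hcx hxa
      by_cases hx : x ∈ E
      · have hxc := hP.mate_eq hμ hcx (by tauto)
        by_cases haE : a ∈ E
        · exact Or.inl ⟨haE, hxc ▸ hxa⟩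
        · have := hP.mate_eq hμ hxa (by tauto)
          rw [hxc, hμμ] at this
          exact Or.inr (Or.inl (this ▸ ha))
      · by_cases haE : a ∈ E
        · have := hP.mate_eq hμ hxa (by tauto)
          exact Or.inr (Or.inr (Or.inr ⟨x, hx, hcx, Or.inr (this ▸ ha)⟩))
        · have := hP.link_unique x c a hx hc haE hcx.symm hxa
          exact Or.inr (Or.inl (this ▸ ha))
    rcases hD c with h1 | ⟨w, hw, hcw⟩ | ⟨a, ha, b, hb, hab, ⟨x, hcx, hxa⟩, y, hcy, hyb⟩
    · exact Or.inl h1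
    · by_cases hwE : w ∈ E
      · exact Or.inr (Or.inl (hP.mate_eq hμ hcw (by tauto) ▸ hw))
      · exact Or.inr (Or.inr ⟨w, hwE, hcw, Or.inl hw⟩)
    · rcases hstep a x ha hcx hxa with ⟨h1, h2⟩ | h1
      · rcases hstep b y hb hcy hyb with ⟨h3, h4⟩ | h3
        · exact absurd (hs a h1 b h3 h2 h4) hab
        · exact h3
      · exact h1
  have hit : ∀ c, c ∉ E → ∃ v ∈ D, v = c ∨ v = μ c ∨ ∃ d, d ∉ E ∧ G.Adj c d ∧ (v = d ∨ v = μ d) := by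
    intro c hc
    have fin : (c ∈ D ∨ μ c ∈ D ∨ ∃ d, d ∉ E ∧ G.Adj c d ∧ (d ∈ D ∨ μ d ∈ D)) →
        ∃ v ∈ D, v = c ∨ v = μ c ∨ ∃ d, d ∉ E ∧ G.Adj c d ∧ (v = d ∨ v = μ d) := by
      rintro (h1 | h1 | ⟨d, hd, hcd, h1 | h1⟩)
      · exact ⟨_, h1, Or.inl rfl⟩
      · exact ⟨_, h1, Or.inr (Or.inl rfl)⟩
      · exact ⟨_, h1, Or.inr (Or.inr ⟨d, hd, hcd, Or.inl rfl⟩)⟩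
      · exact ⟨_, h1, Or.inr (Or.inr ⟨d, hd, hcd, Or.inr rfl⟩)⟩
    by_cases hl : ∀ d, d ∉ E → ¬ G.Adj c d
    · exact fin (crit c hc (h.small_of_leaf _ (hμE hc) c hc (hadj c).symm hl))
    push Not at hl
    obtain ⟨d, hd, hcd⟩ := hl
    rcases h.small_of_link _ (hμE hc) _ (hμE hd) c d hc hd (hadj c).symm hcd (hadj d) with h1 | h1
    · exact fin (crit c hc h1)
    · apply fin
      rcases crit d hd h1 with h2 | h2 | ⟨c', hc', hdc', h2⟩
      · exact Or.inr (Or.inr ⟨d, hd, hcd, Or.inl h2⟩)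
      · exact Or.inr (Or.inr ⟨d, hd, hcd, Or.inr h2⟩)
      · have := hP.link_unique d c' c hd hc' hc hdc' hcd.symm
        subst this
        rcases h2 with h2 | h2
        · exact Or.inl h2
        · exact Or.inr (Or.inl h2)
  choose! f hfD hf using hit
  cases nonempty_fintype V
  let C : Finset V := Finset.univ.filter (· ∉ E)
  -- The inner vertices of each piece have total weight 4: one leaf, or two linked vertices.
  let wt : V → ℕ := fun c => if IsLeaf G c then 4 else 2
  have hsum : weight G = ∑ c ∈ C, wt c := by
    have h1 : ∑ c ∈ C, wt c = ∑ c ∈ C, 2 + ∑ c ∈ C, if IsLeaf G c then 2 else 0 := by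
      rw [← Finset.sum_add_distrib]
      refine Finset.sum_congr rfl fun c _ => ?_
      by_cases hc : IsLeaf G c <;> simp [wt, hc]
    have h2 : C.filter (fun c => IsLeaf G c) = Finset.univ.filter (fun c => IsLeaf G c) := by
      ext c
      simp only [C, Finset.mem_filter, Finset.mem_univ, true_and, and_iff_right_iff_imp]
      exact fun hc => (hP.isLeaf_iff.1 hc).1
    have h3 : (Eᶜ).ncard = C.card := by
      rw [← Set.ncard_coe_finset]
      congr 1
      ext c
      simp [C]
    have h4 : {v | IsLeaf G v}.ncard = (Finset.univ.filter (fun c => IsLeaf G c)).card := by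
      rw [← Set.ncard_coe_finset]
      congr 1
      ext c
      simp
    rw [h1, ← Finset.sum_filter, h2, Finset.sum_const, Finset.sum_const, hP.weight_eq,
      ← hP.ncard_compl, h3, h4]
    simp only [smul_eq_mul]
    ring
  have hmaps : ∀ c ∈ C, f c ∈ D.toFinset := fun c hc => by
    simpa using hfD c (by simpa [C] using hc)
  have hfib : ∀ v ∈ D.toFinset, ∑ c ∈ C with f c = v, wt c ≤ 4 := by
    intro v _
    -- The inner vertex matched with `v` or equal to it. Everything sent to `v` is `b` or its link,
    -- so the fibre lies in one piece.
    let b : V := if v ∈ E then μ v else v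
    have hbE : b ∉ E := by
      by_cases hv : v ∈ E
      · simpa [b, hv] using hEμ hv
      · simp [b, hv]
    have hmem : ∀ c ∈ C.filter (fun c => f c = v), c ∉ E ∧ (c = b ∨ G.Adj c b) := by
      intro c hc
      simp only [C, Finset.mem_filter, Finset.mem_univ, true_and] at hc
      obtain ⟨hc, rfl⟩ := hc
      refine ⟨hc, ?_⟩
      rcases hf c hc with h1 | h1 | ⟨d, hd, hcd, h1 | h1⟩
      · left; simp [b, h1, hc]
      · left; simp [b, h1, hμE hc, hμμ]
      · right; simpa [b, h1, hd] using hcd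
      · right; simpa [b, h1, hμE hd, hμμ] using hcd
    by_cases hl : ∀ d, d ∉ E → ¬ G.Adj b d
    · have hsub : C.filter (fun c => f c = v) ⊆ {b} := by
        intro c hc
        obtain ⟨h1, h2 | h2⟩ := hmem c hc
        · simp [h2]
        · exact absurd h2.symm (hl c h1)
      calc _ ≤ ∑ c ∈ {b}, wt c := Finset.sum_le_sum_of_subset hsub
        _ ≤ 4 := by
          rw [Finset.sum_singleton]
          simp only [wt]
          split_ifs <;> omega
    · push Not at hl
      obtain ⟨d, hd, hbd⟩ := hl
      have hsub : C.filter (fun c => f c = v) ⊆ {b, d} := by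
        intro c hc
        obtain ⟨h1, h2 | h2⟩ := hmem c hc
        · simp [h2]
        · have := hP.link_unique b c d hbE h1 hd h2.symm hbd
          simp [this]
      have h1 : ¬ IsLeaf G b := fun hc => (hP.isLeaf_iff.1 hc).2 d hd hbd
      have h2 : ¬ IsLeaf G d := fun hc => (hP.isLeaf_iff.1 hc).2 b hbE hbd.symm
      calc _ ≤ ∑ c ∈ {b, d}, wt c := Finset.sum_le_sum_of_subset hsub
        _ ≤ 4 := by
          rw [Finset.sum_pair hbd.ne]
          simp [wt, h1, h2]
  rw [hsum, ← Finset.sum_fiberwise_of_maps_to hmaps]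
  calc _ ≤ ∑ v ∈ D.toFinset, 4 := Finset.sum_le_sum hfib
    _ = 4 * D.ncard := by
      rw [Finset.sum_const, Set.ncard_eq_toFinset_card', smul_eq_mul, mul_comm]

/-! ### Attaching a path -/

section attach

variable {V : Type u} {G : SimpleGraph V} {v : V} {k : ℕ}

@[simp] theorem attachPath_inl_inl {a b : V} :
    (attachPath G v k).Adj (.inl a) (.inl b) ↔ G.Adj a b := Iff.rfl

@[simp] theorem attachPath_inl_inr {a : V} {i : Fin k} :
    (attachPath G v k).Adj (.inl a) (.inr i) ↔ a = v ∧ i.val = 0 := Iff.rfl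

@[simp] theorem attachPath_inr_inl {a : V} {i : Fin k} :
    (attachPath G v k).Adj (.inr i) (.inl a) ↔ a = v ∧ i.val = 0 := Iff.rfl

@[simp] theorem attachPath_inr_inr {i j : Fin k} :
    (attachPath G v k).Adj (.inr i) (.inr j) ↔ i.val + 1 = j.val ∨ j.val + 1 = i.val :=
  SimpleGraph.pathGraph_adj

/-- The inclusion of a graph in the graph with a path attached. -/
def attachInl (G : SimpleGraph V) (v : V) (k : ℕ) : G ↪g attachPath G v k where
  toFun := Sum.inl
  inj' := Sum.inl_injective
  map_rel_iff' := Iff.rfl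

/-- Attaching a shorter path gives an induced subgraph. -/
def attachCast (G : SimpleGraph V) (v : V) {j k : ℕ} (h : j ≤ k) :
    attachPath G v j ↪g attachPath G v k where
  toFun := Sum.map id (Fin.castLE h)
  inj' := Function.injective_id.sumMap (Fin.castLE_injective h)
  map_rel_iff' := by
    rintro (a | i) (b | j) <;> simp

theorem attachPath_connected (hG : G.Connected) (v : V) (k : ℕ) : (attachPath G v k).Connected := by
  have h1 : ∀ a b, G.Reachable a b → (attachPath G v k).Reachable (.inl a) (.inl b) :=
    fun a b h => h.map (attachInl G v k).toHom
  have h2 : ∀ (i : ℕ) (hi : i < k), (attachPath G v k).Reachable (.inr ⟨i, hi⟩) (.inl v) := by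
    intro i
    induction i with
    | zero => exact fun hi => SimpleGraph.Adj.reachable (by simp)
    | succ i ih => exact fun hi => (SimpleGraph.Adj.reachable (by simp)).trans (ih (by omega))
  have h3 : ∀ x, (attachPath G v k).Reachable x (.inl v) := by
    rintro (a | ⟨i, hi⟩)
    · exact h1 _ _ (hG.preconnected a v)
    · exact h2 i hi
  exact { preconnected := fun x y => (h3 x).trans (h3 y).symm, nonempty := ⟨.inl v⟩ }

/-- Contracting the attached path onto `v` turns walks into chains of reachability in `G`. -/
theorem connected_of_attachPath (h : (attachPath G v k).Connected) : G.Connected := by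
  let f : V ⊕ Fin k → V := Sum.elim id fun _ => v
  have hf : ∀ x y, (attachPath G v k).Adj x y → G.Reachable (f x) (f y) := by
    rintro (a | i) (b | j) hxy
    · exact SimpleGraph.Adj.reachable hxy
    · rw [attachPath_inl_inr] at hxy
      rw [hxy.1]
      exact SimpleGraph.Reachable.refl _
    · rw [attachPath_inr_inl] at hxy
      rw [hxy.1]
      exact SimpleGraph.Reachable.refl _
    · exact SimpleGraph.Reachable.refl _
  have hw : ∀ x y, (attachPath G v k).Walk x y → G.Reachable (f x) (f y) := by
    intro x y p
    induction p with
    | nil => exact SimpleGraph.Reachable.refl _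
    | cons hxy _ ih => exact (hf _ _ hxy).trans ih
  exact
    { preconnected := fun a b => (h.preconnected (.inl a) (.inl b)).elim (hw _ _)
      nonempty := ⟨v⟩ }

theorem isTree_of_attachPath (h : (attachPath G v k).IsTree) : G.IsTree :=
  ⟨connected_of_attachPath h.connected, h.isAcyclic.embedding (attachInl G v k)⟩

theorem attachPath_isTree_of_le (h : (attachPath G v k).IsTree) {j : ℕ} (hj : j ≤ k) :
    (attachPath G v j).IsTree :=
  ⟨attachPath_connected (connected_of_attachPath h.connected) v j,
    h.isAcyclic.embedding (attachCast G v hj)⟩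

/-! ### Weights -/

theorem isLeaf_inl_iff {a : V} (ha : a ≠ v) : IsLeaf (attachPath G v k) (.inl a) ↔ IsLeaf G a := by
  rw [isLeaf_iff, isLeaf_iff]
  constructor
  · rintro ⟨w | i, hw, h⟩
    · exact ⟨w, hw, fun x hx => Sum.inl_injective (h (.inl x) hx)⟩
    · exact absurd hw.1 ha
  · rintro ⟨w, hw, h⟩
    refine ⟨.inl w, hw, ?_⟩
    rintro (x | i) hx
    · rw [h x hx]
    · exact absurd hx.1 ha

theorem not_isLeaf_inl (hv : ∃ w, G.Adj v w) (hk : 1 ≤ k) :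
    ¬ IsLeaf (attachPath G v k) (.inl v) := by
  obtain ⟨w, hw⟩ := hv
  exact Branching.not_isLeaf ⟨.inl w, .inr ⟨0, hk⟩, by simp, hw, by simp⟩

theorem isLeaf_inr_iff (i : Fin k) :
    IsLeaf (attachPath G v k) (.inr i) ↔ i.val + 1 = k := by
  constructor
  · intro h
    by_contra hi
    revert h
    have hi' : i.val + 1 < k := by omega
    apply Branching.not_isLeaf
    by_cases h0 : i.val = 0
    · exact ⟨.inl v, .inr ⟨i.val + 1, hi'⟩, by simp, by simp [h0], by simp⟩
    · refine ⟨.inr ⟨i.val - 1, by omega⟩, .inr ⟨i.val + 1, hi'⟩, ?_, ?_, by simp⟩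
      · intro h
        rw [Sum.inr.injEq, Fin.mk.injEq] at h
        omega
      · rw [attachPath_inr_inr]
        exact Or.inr (by simp; omega)
  · intro hi
    rw [isLeaf_iff]
    by_cases h0 : i.val = 0
    · refine ⟨.inl v, by simp [h0], ?_⟩
      rintro (x | j) hx
      · rw [hx.1]
      · rw [attachPath_inr_inr] at hx
        omega
    · refine ⟨.inr ⟨i.val - 1, by omega⟩, ?_, ?_⟩
      · rw [attachPath_inr_inr]
        exact Or.inr (by simp; omega)
      · rintro (x | j) hx
        · exact absurd hx.2 h0
        · rw [attachPath_inr_inr] at hx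
          congr 1
          ext
          simp only
          omega

theorem numLeaves_attachPath [Finite V] (hv : ∃ w, G.Adj v w) (hk : 1 ≤ k) :
    numLeaves (attachPath G v k) = ({a | IsLeaf G a} \ {v}).ncard + 1 := by
  have : {x | IsLeaf (attachPath G v k) x} =
      insert (.inr ⟨k - 1, by omega⟩) (Sum.inl '' ({a | IsLeaf G a} \ {v})) := by
    ext x
    constructor
    · intro hx
      rcases x with a | i
      · have ha : a ≠ v := by
          rintro rfl
          exact not_isLeaf_inl hv hk hx
        exact Or.inr ⟨a, ⟨(isLeaf_inl_iff ha).1 hx, ha⟩, rfl⟩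
      · left
        have := (isLeaf_inr_iff i).1 hx
        congr 1
        ext
        simp only
        omega
    · rintro (rfl | ⟨a, ⟨ha, hav⟩, rfl⟩)
      · exact (isLeaf_inr_iff _).2 (by simp only; omega)
      · exact (isLeaf_inl_iff hav).2 ha
  unfold numLeaves
  rw [this, Set.ncard_insert_of_notMem (by simp), Set.ncard_image_of_injective _ Sum.inl_injective]

/-- The vertices adjacent to a leaf different from `v`. -/
def supportsAvoiding (G : SimpleGraph V) (v : V) : Set V :=
  {a | ∃ w, G.Adj a w ∧ IsLeaf G w ∧ w ≠ v}

theorem numSupports_attachPath_ge [Finite V] (hk : 2 ≤ k) :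
    (supportsAvoiding G v).ncard + 1 ≤ numSupports (attachPath G v k) := by
  have : insert (.inr ⟨k - 2, by omega⟩) (Sum.inl '' supportsAvoiding G v) ⊆
      {x | IsSupport (attachPath G v k) x} := by
    rintro x (rfl | ⟨a, ⟨w, haw, hw, hwv⟩, rfl⟩)
    · refine ⟨.inr ⟨k - 1, by omega⟩, ?_, (isLeaf_inr_iff _).2 (by simp only; omega)⟩
      rw [attachPath_inr_inr]
      exact Or.inl (by simp only; omega)
    · exact ⟨.inl w, haw, (isLeaf_inl_iff hwv).2 hw⟩
  have h := Set.ncard_le_ncard this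
  rwa [Set.ncard_insert_of_notMem (by simp),
    Set.ncard_image_of_injective _ Sum.inl_injective] at h

theorem numSupports_attachPath_one [Finite V] (hv : ∃ w, G.Adj v w) :
    numSupports (attachPath G v 1) = (insert v (supportsAvoiding G v)).ncard := by
  have : {x | IsSupport (attachPath G v 1) x} = Sum.inl '' insert v (supportsAvoiding G v) := by
    ext x
    constructor
    · rintro ⟨w | i, hxw, hw⟩
      · have hwv : w ≠ v := by
          rintro rfl
          exact not_isLeaf_inl hv le_rfl hw
        rcases x with a | j
        · exact ⟨a, Or.inr ⟨w, hxw, (isLeaf_inl_iff hwv).1 hw, hwv⟩, rfl⟩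
        · exact absurd hxw.1 hwv
      · rcases x with a | j
        · exact ⟨a, Or.inl hxw.1, rfl⟩
        · rw [attachPath_inr_inr] at hxw
          omega
    · rintro ⟨a, rfl | ⟨w, haw, hw, hwv⟩, rfl⟩
      · exact ⟨.inr 0, by simp, (isLeaf_inr_iff _).2 rfl⟩
      · exact ⟨.inl w, haw, (isLeaf_inl_iff hwv).2 hw⟩
  unfold numSupports
  rw [this, Set.ncard_image_of_injective _ Sum.inl_injective]

theorem card_attach (V : Type u) [Finite V] (k : ℕ) : Nat.card (V ⊕ Fin k) = Nat.card V + k := by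
  rw [Nat.card_sum, Nat.card_fin]

theorem weight_attachPath_ge [Finite V] (hv : ∃ w, G.Adj v w) (hk : 2 ≤ k) :
    Nat.card V + ({a | IsLeaf G a} \ {v}).ncard + (supportsAvoiding G v).ncard + k + 2 ≤
      weight (attachPath G v k) := by
  unfold weight
  rw [card_attach, numLeaves_attachPath hv (by omega)]
  have := numSupports_attachPath_ge (G := G) (v := v) hk
  omega

theorem weight_attachPath_one [Finite V] (hv : ∃ w, G.Adj v w) :
    weight (attachPath G v 1) = Nat.card V + ({a | IsLeaf G a} \ {v}).ncard +
      (insert v (supportsAvoiding G v)).ncard + 2 := by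
  unfold weight
  rw [card_attach, numLeaves_attachPath hv le_rfl, numSupports_attachPath_one hv]
  omega

/-- Lengthening a pendant leaf to a path of `k` vertices adds k - 1 vertices. The support `v` may be
lost, but a new support next to the far leaf replaces it. -/
theorem weight_attachPath_compare [Finite V] (hv : ∃ w, G.Adj v w) (hk : 2 ≤ k) :
    weight (attachPath G v 1) + k ≤ weight (attachPath G v k) + 1 := by
  have h1 := weight_attachPath_ge hv hk
  have h2 := weight_attachPath_one hv
  have h3 := Set.ncard_insert_le v (supportsAvoiding G v)
  omega

theorem leaves_diff_of_branching (hv : Branching G v) :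
    {a | IsLeaf G a} \ {v} = {a | IsLeaf G a} :=
  Set.sdiff_singleton_eq_self hv.not_isLeaf

theorem supportsAvoiding_of_branching (hv : Branching G v) :
    supportsAvoiding G v = {a | IsSupport G a} := by
  ext a
  constructor
  · rintro ⟨w, haw, hw, -⟩
    exact ⟨w, haw, hw⟩
  · rintro ⟨w, haw, hw⟩
    exact ⟨w, haw, hw, fun hc => hv.not_isLeaf (hc ▸ hw)⟩

theorem Branching.exists_adj (hv : Branching G v) : ∃ w, G.Adj v w :=
  let ⟨x, _, _, hx, _⟩ := hv
  ⟨x, hx⟩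

/-- The extra 2 is a new leaf and, since k ≥ 2, a new support. As `v` was no leaf, nothing is lost.
-/
theorem weight_attachPath_of_branching [Finite V] (hv : Branching G v) (hk : 2 ≤ k) :
    weight G + k + 2 ≤ weight (attachPath G v k) := by
  have h := weight_attachPath_ge hv.exists_adj hk
  rw [leaves_diff_of_branching hv, supportsAvoiding_of_branching hv] at h
  unfold weight numLeaves numSupports at *
  omega

theorem weight_attachPath_one_of_branching [Finite V] (hv : Branching G v) :
    weight G + 2 ≤ weight (attachPath G v 1) := by
  have h := weight_attachPath_one hv.exists_adj
  rw [leaves_diff_of_branching hv, supportsAvoiding_of_branching hv] at h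
  have h2 := Set.ncard_le_ncard (Set.subset_insert v {a | IsSupport G a})
  unfold weight numLeaves numSupports at *
  omega

/-- The new leaf and support make up for `v`, which stops being a leaf, and for its neighbour, which
may stop being a support. -/
theorem weight_attachPath_of_isLeaf [Finite V] (hv : IsLeaf G v) (hk : 2 ≤ k) :
    weight G + k ≤ weight (attachPath G v k) := by
  obtain ⟨u, hvu, hu⟩ := isLeaf_iff.1 hv
  have h := weight_attachPath_ge ⟨u, hvu⟩ hk
  have h1 : ({a | IsLeaf G a} \ {v}).ncard + 1 = {a | IsLeaf G a}.ncard :=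
    Set.ncard_sdiff_singleton_add_one hv
  have h2 : {a | IsSupport G a} ⊆ insert u (supportsAvoiding G v) := by
    rintro a ⟨w, haw, hw⟩
    by_cases hwv : w = v
    · subst hwv
      exact Or.inl (hu a haw.symm)
    · exact Or.inr ⟨w, haw, hw, hwv⟩
  have h3 := Set.ncard_le_ncard h2
  have h4 := Set.ncard_insert_le u (supportsAvoiding G v)
  unfold weight numLeaves numSupports at *
  omega

/-! ### Dominating sets -/

/-- Add to a set of old vertices a set of new vertices. -/
def extend (D : Set V) (F : Set (Fin k)) : Set (V ⊕ Fin k) := Sum.inl '' D ∪ Sum.inr '' F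

@[simp] theorem inl_mem_extend {D : Set V} {F : Set (Fin k)} {a : V} :
    Sum.inl a ∈ extend D F ↔ a ∈ D := by simp [extend]

@[simp] theorem inr_mem_extend {D : Set V} {F : Set (Fin k)} {i : Fin k} :
    Sum.inr i ∈ extend D F ↔ i ∈ F := by simp [extend]

theorem ncard_extend_singleton_le [Finite V] (D : Set V) (i : Fin k) :
    (extend D {i}).ncard ≤ D.ncard + 1 := by
  have h := Set.ncard_union_le (Sum.inl '' D) (Sum.inr '' ({i} : Set (Fin k)) : Set (V ⊕ Fin k))
  rwa [Set.ncard_image_of_injective _ Sum.inl_injective,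
    Set.ncard_image_of_injective _ Sum.inr_injective, Set.ncard_singleton] at h

theorem ncard_extend_empty [Finite V] (D : Set V) :
    (extend D (∅ : Set (Fin k))).ncard = D.ncard := by
  rw [extend, Set.image_empty, Set.union_empty, Set.ncard_image_of_injective _ Sum.inl_injective]

theorem dominated_extend {D : Set V} {F : Set (Fin k)} (hD : ∀ a, Dominated G D a)
    (hF : ∀ i, Dominated (attachPath G v k) (extend D F) (.inr i)) (x : V ⊕ Fin k) :
    Dominated (attachPath G v k) (extend D F) x := by
  rcases x with a | i
  · exact (hD a).map (H := attachPath G v k) Sum.inl Sum.inl_injective (fun _ _ h => h)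
      (fun a ha => inl_mem_extend.2 ha)
  · exact hF i

theorem dominated_extend_one {D : Set V} (hD : ∀ a, Dominated G D a)
    (hv : v ∈ D ∨ ∃ a ∈ D, ∃ b ∈ D, a ≠ b ∧ G.Adj v a ∧ G.Adj v b) (x : V ⊕ Fin 1) :
    Dominated (attachPath G v 1) (extend D ∅) x := by
  refine dominated_extend hD (fun i => ?_) x
  rcases hv with hv | ⟨a, ha, b, hb, hab, hva, hvb⟩
  · exact Or.inr (Or.inl ⟨.inl v, by simpa, by simp⟩)
  · exact Or.inr (Or.inr ⟨.inl a, by simpa, .inl b, by simpa, by simpa,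
      ⟨.inl v, by simp, hva⟩, .inl v, by simp, hvb⟩)

theorem dominated_extend_two {D : Set V} (hD : ∀ a, Dominated G D a) (x : V ⊕ Fin 2) :
    Dominated (attachPath G v 2) (extend D {0}) x := by
  refine dominated_extend hD (fun i => ?_) x
  fin_cases i
  · exact Or.inl (by simp)
  · exact Or.inr (Or.inl ⟨.inr 0, by simp, by simp⟩)

theorem dominated_extend_three {D : Set V} (hD : ∀ a, Dominated G D a) (x : V ⊕ Fin 3) :
    Dominated (attachPath G v 3) (extend D {1}) x := by
  refine dominated_extend hD (fun i => ?_) x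
  fin_cases i
  · exact Or.inr (Or.inl ⟨.inr 1, by simp, by simp⟩)
  · exact Or.inl (by simp)
  · exact Or.inr (Or.inl ⟨.inr 1, by simp, by simp⟩)

theorem dominated_extend_four {D : Set V} (hD : ∀ a, Dominated G D a)
    (hv : v ∈ D ∨ ∃ a ∈ D, G.Adj v a) (x : V ⊕ Fin 4) :
    Dominated (attachPath G v 4) (extend D {2}) x := by
  refine dominated_extend hD (fun i => ?_) x
  fin_cases i
  · rcases hv with hv | ⟨a, ha, hva⟩
    · exact Or.inr (Or.inl ⟨.inl v, by simpa, by simp⟩)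
    · exact Or.inr (Or.inr ⟨.inl a, by simpa, .inr 2, by simp, by simp,
        ⟨.inl v, by simp, hva⟩, .inr 1, by simp, by simp⟩)
  · exact Or.inr (Or.inl ⟨.inr 2, by simp, by simp⟩)
  · exact Or.inl (by simp)
  · exact Or.inr (Or.inl ⟨.inr 2, by simp, by simp⟩)

/-- The second new vertex has `v` and the fourth new vertex at distance two, so one new element
serves five vertices once `v` is in the set. -/
theorem dominated_extend_five {D : Set V} (hD : ∀ a, Dominated G D a) (hv : v ∈ D)
    (x : V ⊕ Fin 5) : Dominated (attachPath G v 5) (extend D {3}) x := by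
  refine dominated_extend hD (fun i => ?_) x
  fin_cases i
  · exact Or.inr (Or.inl ⟨.inl v, by simpa, by simp⟩)
  · exact Or.inr (Or.inr ⟨.inl v, by simpa, .inr 3, by simp, by simp,
        ⟨.inr 0, by simp, by simp⟩, .inr 2, by simp, by simp⟩)
  · exact Or.inr (Or.inl ⟨.inr 3, by simp, by simp⟩)
  · exact Or.inl (by simp)
  · exact Or.inr (Or.inl ⟨.inr 3, by simp, by simp⟩)

end attach

/-! ### The bound, and the reductions that preserve it -/

theorem Dominated.mono {V : Type u} {G : SimpleGraph V} {D D' : Set V} (hD : D ⊆ D') {v : V}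
    (h : Dominated G D v) : Dominated G D' v :=
  h.map id Function.injective_id (fun _ _ h => h) hD

/-- The bound on the disjunctive domination number, with the decomposition in the case of
equality. -/
def Bound {V : Type u} (G : SimpleGraph V) : Prop :=
  4 * disjDomNumber G ≤ weight G ∧ (4 * disjDomNumber G = weight G → ∃ E, Pieces G E)

/-- A strict inequality makes the equality clause vacuous. -/
theorem Bound.of_lt {V : Type u} [Finite V] {G : SimpleGraph V} {D : Set V}
    (hD : ∀ v, Dominated G D v) (h : 4 * D.ncard < weight G) : Bound G := by
  have := disjDomNumber_le hD
  exact ⟨by omega, fun _ => by omega⟩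

theorem Bound.exists_dominating {V : Type u} [Finite V] {G : SimpleGraph V} (h : Bound G) :
    ∃ D : Set V, (∀ v, Dominated G D v) ∧ 4 * D.ncard ≤ weight G := by
  obtain ⟨D, hD, hc⟩ := DisjDom.exists_dominating G
  exact ⟨D, hD, by rw [hc]; exact h.1⟩

theorem Pieces.iso {V : Type u} {W : Type w} {G : SimpleGraph V} {H : SimpleGraph W} (e : G ≃g H) {E : Set V}
    (h : Pieces G E) : Pieces H (e.symm ⁻¹' E) := by
  have ha : ∀ {a b}, H.Adj a b → G.Adj (e.symm a) (e.symm b) := fun {a b} hab =>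
    e.symm.map_adj_iff.2 hab
  have hb : ∀ {a b}, G.Adj (e.symm a) b → H.Adj a (e b) := fun {a b} hab => by
    rw [← e.symm.map_adj_iff]; simpa using hab
  refine ⟨?_, ?_, ?_, ?_, ?_, ?_⟩
  · intro x hx
    obtain ⟨c, hc, hxc⟩ := h.exists_inner _ hx
    exact ⟨e c, by simpa using hc, hb hxc⟩
  · intro x hx c c' hc hc' h1 h2
    exact e.symm.injective (h.inner_unique _ hx _ _ hc hc' (ha h1) (ha h2))
  · intro x hx
    obtain ⟨c, hc, hxc⟩ := h.exists_end _ hx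
    exact ⟨e c, by simpa using hc, hb hxc⟩
  · intro x hx c hc c' hc' h1 h2
    exact e.symm.injective (h.end_unique _ hx _ hc _ hc' (ha h1) (ha h2))
  · intro x c c' hx hc hc' h1 h2
    exact e.symm.injective (h.link_unique _ _ _ hx hc hc' (ha h1) (ha h2))
  · intro x hx
    obtain ⟨c, hc, hxc⟩ := h.exists_adj_end _ hx
    exact ⟨e c, by simpa using hc, hb hxc⟩

theorem Bound.iso {V W : Type u} [Finite V] [Finite W] {G : SimpleGraph V} {H : SimpleGraph W}
    (e : G ≃g H) (h : Bound G) : Bound H := by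
  unfold Bound
  rw [weight_iso e, disjDomNumber_iso e]
  exact ⟨h.1, fun heq => let ⟨_, hE⟩ := h.2 heq; ⟨_, hE.iso e⟩⟩

section reductions

variable {V : Type u} {G : SimpleGraph V} {v : V}

/-- Attaching a piece with two vertices to an end. -/
theorem Pieces.attach_two {E : Set V} (h : Pieces G E) (hv : v ∈ E) :
    Pieces (attachPath G v 2) (extend E {0}) := by
  refine ⟨?_, ?_, ?_, ?_, ?_, ?_⟩
  · rintro (e | i) he
    · obtain ⟨c, hc, hec⟩ := h.exists_inner e (by simpa using he)
      exact ⟨.inl c, by simpa using hc, hec⟩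
    · exact ⟨.inr 1, by simp, by simp at he; simp [he]⟩
  · rintro (e | i) he (c | j) (c' | j') hc hc' h1 h2 <;>
      simp only [inl_mem_extend, inr_mem_extend, Set.mem_singleton_iff, attachPath_inl_inl,
        attachPath_inl_inr, attachPath_inr_inl, attachPath_inr_inr, Sum.inl.injEq,
        Sum.inr.injEq] at *
    · exact h.inner_unique e he c c' hc hc' h1 h2
    all_goals grind
  · rintro (c | i) hc
    · obtain ⟨e, he, hce⟩ := h.exists_end c (by simpa using hc)
      exact ⟨.inl e, by simpa using he, hce⟩
    · exact ⟨.inr 0, by simp, by simp at hc ⊢; omega⟩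
  · rintro (e | i) he (c | j) hc (c' | j') hc' h1 h2 <;>
      simp only [inl_mem_extend, inr_mem_extend, Set.mem_singleton_iff, attachPath_inl_inl,
        attachPath_inl_inr, attachPath_inr_inl, attachPath_inr_inr, Sum.inl.injEq,
        Sum.inr.injEq] at *
    · exact h.end_unique e he c hc c' hc' h1 h2
    all_goals grind
  · rintro (e | i) (c | j) (c' | j') he hc hc' h1 h2 <;>
      simp only [inl_mem_extend, inr_mem_extend, Set.mem_singleton_iff, attachPath_inl_inl,
        attachPath_inl_inr, attachPath_inr_inl, attachPath_inr_inr, Sum.inl.injEq,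
        Sum.inr.injEq] at *
    · exact h.link_unique e c c' he hc hc' h1 h2
    all_goals grind
  · rintro (e | i) he
    · obtain ⟨c, hc, hec⟩ := h.exists_adj_end e (by simpa using he)
      exact ⟨.inl c, by simpa using hc, hec⟩
    · exact ⟨.inl v, by simpa using hv, by simp at he; simp [he]⟩

/-- Extending a piece with two vertices to one with four, and attaching a piece with two vertices
to the new end. -/
theorem Pieces.attach_four {E : Set V} (h : Pieces G E) (hv : IsLeaf G v) :
    Pieces (attachPath G v 4) (extend E {1, 2}) := by
  obtain ⟨hvE, hvd⟩ := h.isLeaf_iff.1 hv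
  refine ⟨?_, ?_, ?_, ?_, ?_, ?_⟩
  · rintro (e | i) he
    · obtain ⟨c, hc, hec⟩ := h.exists_inner e (by simpa using he)
      exact ⟨.inl c, by simpa using hc, hec⟩
    · simp only [inr_mem_extend, Set.mem_insert_iff, Set.mem_singleton_iff] at he
      rcases he with rfl | rfl
      · exact ⟨.inr 0, by simp, by simp⟩
      · exact ⟨.inr 3, by simp, by simp⟩
  · rintro (e | i) he (c | j) (c' | j') hc hc' h1 h2 <;>
      simp only [inl_mem_extend, inr_mem_extend, Set.mem_singleton_iff, attachPath_inl_inl,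
        attachPath_inl_inr, attachPath_inr_inl, attachPath_inr_inr, Sum.inl.injEq,
        Sum.inr.injEq, Set.mem_insert_iff] at *
    · exact h.inner_unique e he c c' hc hc' h1 h2
    all_goals grind
  · rintro (c | i) hc
    · obtain ⟨e, he, hce⟩ := h.exists_end c (by simpa using hc)
      exact ⟨.inl e, by simpa using he, hce⟩
    · simp only [inr_mem_extend, Set.mem_insert_iff, Set.mem_singleton_iff] at hc
      by_cases hi : i = 0
      · exact ⟨.inr 1, by simp, by simp [hi]⟩
      · refine ⟨.inr 2, by simp, ?_⟩
        have : i = 3 := by omega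
        simp [this]
  · rintro (e | i) he (c | j) hc (c' | j') hc' h1 h2 <;>
      simp only [inl_mem_extend, inr_mem_extend, Set.mem_singleton_iff, attachPath_inl_inl,
        attachPath_inl_inr, attachPath_inr_inl, attachPath_inr_inr, Sum.inl.injEq,
        Sum.inr.injEq, Set.mem_insert_iff] at *
    · exact h.end_unique e he c hc c' hc' h1 h2
    all_goals grind
  · rintro (e | i) (c | j) (c' | j') he hc hc' h1 h2 <;>
      simp only [inl_mem_extend, inr_mem_extend, Set.mem_singleton_iff, attachPath_inl_inl,
        attachPath_inl_inr, attachPath_inr_inl, attachPath_inr_inr, Sum.inl.injEq,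
        Sum.inr.injEq, Set.mem_insert_iff] at *
    · exact h.link_unique e c c' he hc hc' h1 h2
    · exact absurd (h2.1 ▸ h1) (hvd c hc)
    · exact absurd (h1.1 ▸ h2) (hvd c' hc')
    all_goals grind
  · rintro (e | i) he
    · obtain ⟨c, hc, hec⟩ := h.exists_adj_end e (by simpa using he)
      exact ⟨.inl c, by simpa using hc, hec⟩
    · simp only [inr_mem_extend, Set.mem_insert_iff, Set.mem_singleton_iff] at he
      rcases he with rfl | rfl
      · exact ⟨.inr 2, by simp, by simp⟩
      · exact ⟨.inr 1, by simp, by simp⟩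

theorem branching_attach {k : ℕ} (hv : ∃ w, G.Adj v w) (hk : 1 ≤ k) :
    Branching (attachPath G v k) (.inl v) := by
  obtain ⟨w, hw⟩ := hv
  exact ⟨.inl w, .inr ⟨0, hk⟩, by simp, hw, by simp⟩

theorem strong_extend {k : ℕ} {D : Set V} {F : Set (Fin k)}
    (h : v ∈ D ∨ ∃ a ∈ D, ∃ b ∈ D, a ≠ b ∧ G.Adj v a ∧ G.Adj v b) :
    .inl v ∈ extend D F ∨ ∃ a ∈ extend D F, ∃ b ∈ extend D F, a ≠ b ∧
      (attachPath G v k).Adj (.inl v) a ∧ (attachPath G v k).Adj (.inl v) b := by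
  rcases h with h | ⟨a, ha, b, hb, hab, h1, h2⟩
  · exact Or.inl (by simpa)
  · exact Or.inr ⟨.inl a, by simpa, .inl b, by simpa, by simpa, h1, h2⟩

theorem adj_of_strong {D : Set V}
    (h : v ∈ D ∨ ∃ a ∈ D, ∃ b ∈ D, a ≠ b ∧ G.Adj v a ∧ G.Adj v b) :
    v ∈ D ∨ ∃ a ∈ D, G.Adj v a := by
  rcases h with h | ⟨a, ha, -, -, -, h1, -⟩
  · exact Or.inl h
  · exact Or.inr ⟨a, ha, h1⟩

/-! ### Reductions attaching a single path -/

variable [Finite V]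

/-- One vertex is paid for a gain of at least 4, so equality passes down to `G`. It also forces `v`
to be an end, where a new piece can be attached. -/
theorem bound_attach_two (hG : G.IsTree) (hv : Branching G v) (h : Bound G) :
    Bound (attachPath G v 2) := by
  obtain ⟨D, hD, hc⟩ := exists_dominating G
  have h1 := disjDomNumber_le (dominated_extend_two (v := v) hD)
  have h2 := ncard_extend_singleton_le D (0 : Fin 2)
  have h3 := weight_attachPath_of_branching hv (le_refl 2)
  have h4 := h.1
  refine ⟨by omega, fun heq => ?_⟩
  obtain ⟨E, hE⟩ := h.2 (by omega)
  by_cases hvE : v ∈ E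
  · exact ⟨_, hE.attach_two hvE⟩
  -- If `v` were inner, rooting at `v` would leave only the piece of `v` undominated. The first new
  -- vertex dominates `v` and, together with an end beyond the far end, its link. This saves one
  -- vertex.
  exfalso
  obtain ⟨D', hcard, hdom, -, hD'⟩ := hE.exists_nearly_dominating hG hvE
  have h5 : ∀ x, Dominated (attachPath G v 2) (extend D' {0}) x := by
    rintro (a | i)
    · by_cases hav : a = v
      · subst hav
        exact Or.inr (Or.inl ⟨.inr 0, by simp, by simp⟩)
      by_cases ha : a ∉ E ∧ G.Adj a v
      · obtain ⟨e, he, hae⟩ := hE.exists_end a ha.1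
        obtain ⟨x, hx, hex⟩ := hE.exists_adj_end e he
        exact Or.inr (Or.inr ⟨.inr 0, by simp, .inl x,
          by simpa using hD' a ha.1 ha.2.symm e he hae x hx hex, by simp,
          ⟨.inl v, ha.2, by simp⟩, .inl e, hae, hex⟩)
      · exact (hdom a hav (by tauto)).map (H := attachPath G v 2) Sum.inl Sum.inl_injective
          (fun _ _ h => h) (fun a ha => inl_mem_extend.2 ha)
    · fin_cases i
      · exact Or.inl (by simp)
      · exact Or.inr (Or.inl ⟨.inr 0, by simp, by simp⟩)
  have h6 := disjDomNumber_le h5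
  have h7 := ncard_extend_singleton_le D' (0 : Fin 2)
  omega

theorem bound_attach_three (hv : Branching G v) (h : Bound G) : Bound (attachPath G v 3) := by
  obtain ⟨D, hD, hc⟩ := h.exists_dominating
  refine Bound.of_lt (dominated_extend_three (v := v) hD) ?_
  have h2 := ncard_extend_singleton_le D (1 : Fin 3)
  have h3 := weight_attachPath_of_branching hv (k := 3) (by omega)
  omega

/-- Since `u` has at most one neighbour besides `v`, the leaf `v` cannot be dominated by two
vertices at distance two. So `v` or `u` is in the set, and it helps to dominate the first new
vertex. -/
theorem bound_attach_four {u x : V} (hv : IsLeaf G v) (hvu : G.Adj v u)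
    (hu : ∀ y, G.Adj u y → y = v ∨ y = x) (h : Bound G) : Bound (attachPath G v 4) := by
  obtain ⟨D, hD, hc⟩ := exists_dominating G
  have huniq : ∀ w, G.Adj v w → w = u := by
    obtain ⟨w, -, hw⟩ := isLeaf_iff.1 hv
    exact fun y hy => (hw y hy).trans (hw u hvu).symm
  have hDv : v ∈ D ∨ ∃ a ∈ D, G.Adj v a := by
    rcases hD v with h1 | h1 | ⟨a, ha, b, hb, hab, ⟨y, hvy, hya⟩, z, hvz, hzb⟩
    · exact Or.inl h1
    · exact Or.inr h1
    · left
      rw [huniq y hvy] at hya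
      rw [huniq z hvz] at hzb
      rcases hu a hya with rfl | rfl
      · exact ha
      rcases hu b hzb with rfl | rfl
      · exact hb
      exact absurd rfl hab
  have h1 := disjDomNumber_le (dominated_extend_four hD hDv)
  have h2 := ncard_extend_singleton_le D (2 : Fin 4)
  have h3 := weight_attachPath_of_isLeaf hv (k := 4) (by omega)
  have h4 := h.1
  refine ⟨by omega, fun heq => ?_⟩
  obtain ⟨E, hE⟩ := h.2 (by omega)
  exact ⟨_, hE.attach_four hv⟩

/-- A dominating set of `G` that would also dominate a new leaf at `v`. -/
theorem exists_strongly_dominating (h : Bound (attachPath G v 1)) :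
    ∃ D : Set V, (∀ a, Dominated G D a) ∧
      (v ∈ D ∨ ∃ a ∈ D, ∃ b ∈ D, a ≠ b ∧ G.Adj v a ∧ G.Adj v b) ∧
      4 * D.ncard ≤ weight (attachPath G v 1) := by
  obtain ⟨D', hD', hc⟩ := h.exists_dominating
  have hfin : ∀ i : Fin 1, i = 0 := fun i => Subsingleton.elim _ _
  have key : ∀ D : Set V, (∀ a, Sum.inl a ∈ D' → a ∈ D) → (Sum.inr 0 ∈ D' → v ∈ D) →
      ∀ a, Dominated G D a := by
    intro D h1 h2 a
    have hstep : ∀ y x, y ∈ D' → (attachPath G v 1).Adj (.inl a) x → (attachPath G v 1).Adj x y →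
        Dominated G D a ∨ ∃ b, y = .inl b ∧ ∃ z, G.Adj a z ∧ G.Adj z b := by
      rintro (b | i) (x | j) hy hax hxy
      · exact Or.inr ⟨b, rfl, x, hax, hxy⟩
      · left; left
        rw [hax.1, ← hxy.1]
        exact h1 b hy
      · left
        rw [hfin i] at hy
        rw [attachPath_inl_inr] at hxy
        exact Or.inr (Or.inl ⟨v, h2 hy, hxy.1 ▸ hax⟩)
      · rw [attachPath_inr_inr] at hxy
        omega
    rcases hD' (.inl a) with h3 | ⟨w, hw, haw⟩ | ⟨y, hy, z, hz, hyz, ⟨x, hax, hxy⟩, x', hax', hxz⟩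
    · exact Or.inl (h1 a h3)
    · rcases w with b | i
      · exact Or.inr (Or.inl ⟨b, h1 b hw, haw⟩)
      · rw [hfin i] at hw
        exact Or.inl (haw.1 ▸ h2 hw)
    · rcases hstep y x hy hax hxy with h3 | ⟨b, rfl, h4⟩
      · exact h3
      rcases hstep z x' hz hax' hxz with h3 | ⟨b', rfl, h5⟩
      · exact h3
      exact Or.inr (Or.inr ⟨b, h1 b hy, b', h1 b' hz, fun hc => hyz (by rw [hc]), h4, h5⟩)
  -- If the new leaf belongs to the set, it is exchanged for `v` at no cost.
  by_cases h0 : Sum.inr 0 ∈ D'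
  · refine ⟨insert v (Sum.inl ⁻¹' D'), key _ (fun a ha => Or.inr ha) (fun _ => Or.inl rfl),
      Or.inl (Or.inl rfl), ?_⟩
    have h1 := Set.ncard_insert_le v (Sum.inl ⁻¹' D')
    have h2 : insert (Sum.inr 0) (Sum.inl '' (Sum.inl ⁻¹' D')) ⊆ D' := by
      rintro x (rfl | ⟨a, ha, rfl⟩)
      · exact h0
      · exact ha
    have h3 := Set.ncard_le_ncard h2
    rw [Set.ncard_insert_of_notMem (by simp),
      Set.ncard_image_of_injective _ Sum.inl_injective] at h3
    omega
  · refine ⟨Sum.inl ⁻¹' D', key _ (fun a ha => ha) (fun h => absurd h h0), ?_, ?_⟩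
    · have hstep : ∀ y x, y ∈ D' → (attachPath G v 1).Adj (.inr 0) x →
          (attachPath G v 1).Adj x y → ∃ b, y = .inl b ∧ G.Adj v b := by
        rintro (b | i) (x | j) hy hax hxy
        · exact ⟨b, rfl, hax.1 ▸ hxy⟩
        · rw [attachPath_inr_inr] at hax
          omega
        · exact absurd (hfin i ▸ hy) h0
        · exact absurd (hfin i ▸ hy) h0
      rcases hD' (.inr 0) with h3 | ⟨w, hw, haw⟩ | ⟨y, hy, z, hz, hyz, ⟨x, hax, hxy⟩, x', hax', hxz⟩
      · exact absurd h3 h0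
      · rcases w with b | i
        · left
          rw [← haw.1]
          exact hw
        · exact absurd (hfin i ▸ hw) h0
      · obtain ⟨b, rfl, hb⟩ := hstep y x hy hax hxy
        obtain ⟨b', rfl, hb'⟩ := hstep z x' hz hax' hxz
        exact Or.inr ⟨b, hy, b', hz, fun hc => hyz (by rw [hc]), hb, hb'⟩
    · have h2 : Sum.inl '' (Sum.inl ⁻¹' D') ⊆ D' := by
        rintro x ⟨a, ha, rfl⟩
        exact ha
      have h3 := Set.ncard_le_ncard h2
      rw [Set.ncard_image_of_injective _ Sum.inl_injective] at h3
      omega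

/-! ### Two paths attached to the same vertex -/

/-- The set dominating one pendant leaf also dominates a second one for free, while the weight grows
by at least 2. -/
theorem bound_attach_one_one (hv : ∃ w, G.Adj v w) (h : Bound (attachPath G v 1)) :
    Bound (attachPath (attachPath G v 1) (.inl v) 1) := by
  obtain ⟨D, hD, hs, hc⟩ := exists_strongly_dominating h
  refine Bound.of_lt (dominated_extend_one (dominated_extend_one hD hs) (strong_extend hs)) ?_
  have h3 := weight_attachPath_one_of_branching (branching_attach hv (le_refl 1))
  rw [ncard_extend_empty, ncard_extend_empty]
  omega

theorem bound_attach_one_four (hv : ∃ w, G.Adj v w) (h : Bound (attachPath G v 1)) :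
    Bound (attachPath (attachPath G v 1) (.inl v) 4) := by
  obtain ⟨D, hD, hs, hc⟩ := exists_strongly_dominating h
  refine Bound.of_lt (dominated_extend_four (dominated_extend_one hD hs)
    (adj_of_strong (strong_extend hs))) ?_
  have h3 := weight_attachPath_of_branching (branching_attach hv (le_refl 1)) (k := 4) (by omega)
  have h4 := ncard_extend_singleton_le (extend D (∅ : Set (Fin 1))) (2 : Fin 4)
  rw [ncard_extend_empty] at h4
  omega

/-- Measured from the tree with one pendant leaf, the weight grows by at least 3 + 6 = 9, against 8
for two new elements. -/
theorem bound_attach_four_four (hv : ∃ w, G.Adj v w) (h : Bound (attachPath G v 1)) :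
    Bound (attachPath (attachPath G v 4) (.inl v) 4) := by
  obtain ⟨D, hD, hs, hc⟩ := exists_strongly_dominating h
  refine Bound.of_lt (dominated_extend_four (dominated_extend_four hD (adj_of_strong hs))
    (adj_of_strong (strong_extend hs))) ?_
  have h3 := weight_attachPath_of_branching (branching_attach hv (k := 4) (by omega)) (k := 4)
    (by omega)
  have h4 := ncard_extend_singleton_le (extend D ({2} : Set (Fin 4))) (2 : Fin 4)
  have h5 := ncard_extend_singleton_le D (2 : Fin 4)
  have h6 := weight_attachPath_compare hv (k := 4) (by omega)
  omega

/-- At most three new elements, `v` and one on each path, cost 12 against a gain of at least 7 + 7.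
-/
theorem bound_attach_five_five (hv : Branching G v) (h : Bound G) :
    Bound (attachPath (attachPath G v 5) (.inl v) 5) := by
  obtain ⟨D, hD, hc⟩ := h.exists_dominating
  have hD' : ∀ a, Dominated G (insert v D) a := fun a => (hD a).mono (Set.subset_insert v D)
  refine Bound.of_lt (dominated_extend_five (dominated_extend_five hD' (Set.mem_insert v D))
    (by simp)) ?_
  have h3 := weight_attachPath_of_branching (branching_attach hv.exists_adj (k := 5) (by omega))
    (k := 5) (by omega)
  have h4 := ncard_extend_singleton_le (extend (insert v D) ({3} : Set (Fin 5))) (3 : Fin 5)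
  have h5 := ncard_extend_singleton_le (insert v D) (3 : Fin 5)
  have h6 := weight_attachPath_of_branching hv (k := 5) (by omega)
  have h7 := Set.ncard_insert_le v D
  omega

/-- For k = 1, 4, 5 the weight grows by at least 7, 11, 12, whereas the cost with the excess 2
included is at most 6, 10, 10. -/
theorem bound_attach_five_of_isLeaf (hv : IsLeaf G v) {D : Set V} (hD : ∀ a, Dominated G D a)
    (hvD : v ∈ D) (hc : 4 * D.ncard ≤ weight G + 2) {k : ℕ} (hk : k = 1 ∨ k = 4 ∨ k = 5) :
    Bound (attachPath (attachPath G v 5) (.inl v) k) := by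
  have hv' : ∃ w, G.Adj v w := let ⟨w, hw, _⟩ := isLeaf_iff.1 hv; ⟨w, hw⟩
  have hb := branching_attach hv' (k := 5) (by omega)
  have h1 := ncard_extend_singleton_le D (3 : Fin 5)
  have h2 := weight_attachPath_of_isLeaf hv (k := 5) (by omega)
  have hdom := dominated_extend_five hD hvD
  rcases hk with rfl | rfl | rfl
  · refine Bound.of_lt (dominated_extend_one hdom (Or.inl (by simpa))) ?_
    have h3 := weight_attachPath_one_of_branching hb
    rw [ncard_extend_empty]
    omega
  · refine Bound.of_lt (dominated_extend_four hdom (Or.inl (by simpa))) ?_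
    have h3 := weight_attachPath_of_branching hb (k := 4) (by omega)
    have h4 := ncard_extend_singleton_le (extend D ({3} : Set (Fin 5))) (2 : Fin 4)
    omega
  · refine Bound.of_lt (dominated_extend_five hdom (by simpa)) ?_
    have h3 := weight_attachPath_of_branching hb (k := 5) (by omega)
    have h4 := ncard_extend_singleton_le (extend D ({3} : Set (Fin 5))) (3 : Fin 5)
    omega

end reductions

/-! ### Legs -/

/-- The vertices `f 0, f 1, …` form a path attached to `w` at `f 0` and to nothing else. -/
structure IsLeg {V : Type u} (T : SimpleGraph V) (w : V) {k : ℕ} (f : Fin k → V) : Prop where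
  inj : Function.Injective f
  ne_base : ∀ i, f i ≠ w
  adj_iff : ∀ i z, T.Adj (f i) z ↔
    (∃ j, z = f j ∧ (i.val + 1 = j.val ∨ j.val + 1 = i.val)) ∨ (i.val = 0 ∧ z = w)

/-- There is a leg with `k` vertices at `w` whose first vertex is `x`. -/
def HasLeg {V : Type u} (T : SimpleGraph V) (w x : V) (k : ℕ) : Prop :=
  ∃ f : Fin k → V, IsLeg T w f ∧ ∃ h : 0 < k, f ⟨0, h⟩ = x

section legs

variable {V W : Type u} {T : SimpleGraph V}

theorem HasLeg.one {p x : V} (hpx : T.Adj p x) (hx : ∀ y, T.Adj x y → y = p) :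
    HasLeg T p x 1 := by
  refine ⟨fun _ => x, ⟨fun _ _ _ => Subsingleton.elim _ _, fun _ => hpx.ne', fun i z => ?_⟩,
    Nat.one_pos, rfl⟩
  constructor
  · intro h
    exact Or.inr ⟨by omega, hx z h⟩
  · rintro (⟨j, -, h⟩ | ⟨-, rfl⟩)
    · omega
    · exact hpx.symm

theorem HasLeg.cons {p x y : V} {k : ℕ} (h : HasLeg T x y k) (hpx : T.Adj p x) (hpy : p ≠ y)
    (hx : ∀ z, T.Adj x z → z = p ∨ z = y) : HasLeg T p x (k + 1) := by
  obtain ⟨f, hf, hk, rfl⟩ := h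
  have hxy : T.Adj x (f ⟨0, hk⟩) := by
    rw [T.adj_comm, hf.adj_iff]
    exact Or.inr ⟨rfl, rfl⟩
  refine ⟨Fin.cons x f, ⟨?_, ?_, ?_⟩, Nat.succ_pos k, rfl⟩
  · rw [Fin.cons_injective_iff]
    exact ⟨fun ⟨i, hi⟩ => hf.ne_base i hi, hf.inj⟩
  · intro i
    refine Fin.cases ?_ (fun i => ?_) i
    · exact hpx.ne'
    · rw [Fin.cons_succ]
      intro hc
      have h1 : T.Adj (f i) x := hc ▸ hpx
      rw [hf.adj_iff] at h1
      rcases h1 with ⟨j, hj, -⟩ | ⟨h0, -⟩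
      · exact hf.ne_base j hj.symm
      · exact hpy (by rw [← hc]; congr 1; ext; exact h0)
  · intro i z
    refine Fin.cases ?_ (fun i => ?_) i
    · simp only [Fin.cons_zero, Fin.val_zero, true_and]
      constructor
      · intro hz
        rcases hx z hz with rfl | rfl
        · exact Or.inr rfl
        · exact Or.inl ⟨Fin.succ ⟨0, hk⟩, rfl, Or.inl rfl⟩
      · rintro (⟨j, rfl, hj⟩ | rfl)
        · have : j = Fin.succ ⟨0, hk⟩ := by
            ext
            simp only [Fin.val_succ]
            omega
          rw [this, Fin.cons_succ]
          exact hxy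
        · exact hpx.symm
    · rw [Fin.cons_succ, hf.adj_iff]
      constructor
      · rintro (⟨j, rfl, hj⟩ | ⟨h0, rfl⟩)
        · exact Or.inl ⟨j.succ, by simp, by simp only [Fin.val_succ]; omega⟩
        · exact Or.inl ⟨0, rfl, by simp [h0]⟩
      · rintro (⟨j, rfl, hj⟩ | ⟨h0, rfl⟩)
        · revert hj
          refine Fin.cases ?_ (fun j => ?_) j
          · intro hj
            simp only [Fin.val_succ, Fin.val_zero] at hj
            exact Or.inr ⟨by omega, rfl⟩
          · intro hj
            simp only [Fin.val_succ] at hj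
            exact Or.inl ⟨j, by simp, by omega⟩
        · simp at h0

/-- Removing a leg. -/
theorem IsLeg.peel [Finite V] {w : V} {k : ℕ} {f : Fin k → V} (h : IsLeg T w f) :
    ∃ (W : Type u) (_ : Finite W) (G : SimpleGraph W) (v : W) (e : attachPath G v k ≃g T),
      e (.inl v) = w ∧ ∀ i, e (.inr i) = f i := by
  classical
  have hw : w ∉ Set.range f := by
    rintro ⟨i, hi⟩
    exact h.ne_base i hi
  let g : {x // x ∉ Set.range f} ⊕ Fin k → V := Sum.elim Subtype.val f
  have hg : Function.Bijective g := by
    constructor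
    · rintro (⟨a, ha⟩ | i) (⟨b, hb⟩ | j) hab
      · congr 1
        exact Subtype.ext hab
      · exact absurd ⟨j, hab.symm⟩ ha
      · exact absurd ⟨i, hab⟩ hb
      · exact congrArg _ (h.inj hab)
    · intro x
      by_cases hx : x ∈ Set.range f
      · obtain ⟨i, hi⟩ := hx
        exact ⟨.inr i, hi⟩
      · exact ⟨.inl ⟨x, hx⟩, rfl⟩
  have hlr : ∀ (a : {x // x ∉ Set.range f}) (i : Fin k),
      T.Adj (f i) a ↔ a = ⟨w, hw⟩ ∧ i.val = 0 := by
    rintro ⟨a, ha⟩ i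
    rw [h.adj_iff]
    constructor
    · rintro (⟨j, rfl, -⟩ | ⟨h0, rfl⟩)
      · exact absurd ⟨j, rfl⟩ ha
      · exact ⟨rfl, h0⟩
    · rintro ⟨h1, h0⟩
      exact Or.inr ⟨h0, congrArg Subtype.val h1⟩
  refine ⟨{x // x ∉ Set.range f}, inferInstance, T.induce {x | x ∉ Set.range f}, ⟨w, hw⟩,
    ⟨Equiv.ofBijective g hg, ?_⟩, rfl, fun i => rfl⟩
  rintro (a | i) (b | j)
  · exact Iff.rfl
  · change T.Adj a (f j) ↔ _
    rw [T.adj_comm, hlr, attachPath_inl_inr]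
  · change T.Adj (f i) b ↔ _
    rw [hlr, attachPath_inr_inl]
  · change T.Adj (f i) (f j) ↔ _
    rw [h.adj_iff, attachPath_inr_inr]
    constructor
    · rintro (⟨l, hl, h1⟩ | ⟨-, h1⟩)
      · rwa [h.inj hl]
      · exact absurd h1 (h.ne_base j)
    · exact fun h1 => Or.inl ⟨j, rfl, h1⟩

/-- Attaching paths to isomorphic graphs. -/
def attachCongr {G : SimpleGraph V} {H : SimpleGraph W} (e : G ≃g H) (v : V) (k : ℕ) :
    attachPath G v k ≃g attachPath H (e v) k where
  toEquiv := Equiv.sumCongr e.toEquiv (Equiv.refl _)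
  map_rel_iff' := by
    rintro (a | i) (b | j)
    · exact e.map_adj_iff
    · simp
    · simp
    · simp

/-- Two legs at the same vertex with different first vertices are disjoint. -/
theorem IsLeg.disjoint {w : V} {k l : ℕ} {f : Fin k → V} {g : Fin l → V} (hf : IsLeg T w f)
    (hg : IsLeg T w g) (hk : 0 < k) (hl : 0 < l) (hne : f ⟨0, hk⟩ ≠ g ⟨0, hl⟩) :
    ∀ i j, f i ≠ g j := by
  have h0 : ∀ j, f ⟨0, hk⟩ ≠ g j := by
    intro j hj
    have h1 : T.Adj (f ⟨0, hk⟩) w := (hf.adj_iff _ _).2 (Or.inr ⟨rfl, rfl⟩)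
    rw [hj, hg.adj_iff] at h1
    rcases h1 with ⟨l, hl, -⟩ | ⟨h1, -⟩
    · exact hg.ne_base l hl.symm
    · apply hne
      rw [hj]
      congr 1
      ext
      exact h1
  have key : ∀ (i : ℕ) (hi : i < k) (j : Fin l), f ⟨i, hi⟩ ≠ g j := by
    intro i
    induction i with
    | zero => exact fun hi j => h0 j
    | succ i ih =>
      intro hi j hj
      have h1 : T.Adj (f ⟨i + 1, hi⟩) (f ⟨i, by omega⟩) :=
        (hf.adj_iff _ _).2 (Or.inl ⟨_, rfl, Or.inr rfl⟩)
      rw [hj, hg.adj_iff] at h1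
      rcases h1 with ⟨l, hl, -⟩ | ⟨-, h1⟩
      · exact ih _ l hl
      · exact hf.ne_base _ h1
  exact fun i j => key i.1 i.2 j

theorem HasLeg.peel [Finite V] {w x : V} {k : ℕ} (h : HasLeg T w x k) :
    ∃ (W : Type u) (_ : Finite W) (G : SimpleGraph W) (v : W) (e : attachPath G v k ≃g T)
      (hk : 0 < k), e (.inl v) = w ∧ e (.inr ⟨0, hk⟩) = x := by
  obtain ⟨f, hf, hk, rfl⟩ := h
  obtain ⟨W, hW, G, v, e, h1, h2⟩ := hf.peel
  exact ⟨W, hW, G, v, e, hk, h1, h2 _⟩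

/-- By disjointness the first leg survives the removal of the second and can be peeled in turn. -/
theorem HasLeg.peel_two [Finite V] {w x y : V} {k l : ℕ} (hx : HasLeg T w x k)
    (hy : HasLeg T w y l) (hxy : x ≠ y) :
    ∃ (W : Type u) (_ : Finite W) (G : SimpleGraph W) (v : W)
      (e : attachPath (attachPath G v k) (.inl v) l ≃g T) (hk : 0 < k) (hl : 0 < l),
      e (.inl (.inl v)) = w ∧ e (.inl (.inr ⟨0, hk⟩)) = x ∧ e (.inr ⟨0, hl⟩) = y := by
  obtain ⟨f, hf, hk, rfl⟩ := hx
  obtain ⟨g, hg, hl, rfl⟩ := hy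
  have hdis := hf.disjoint hg hk hl hxy
  obtain ⟨W₁, hW₁, G₁, v₁, e, h1, h2⟩ := hg.peel
  have hinl : ∀ i, ∃ a, e (.inl a) = f i := by
    intro i
    obtain ⟨a | j, ha⟩ := e.surjective (f i)
    · exact ⟨a, ha⟩
    · exact absurd ((h2 j).symm.trans ha).symm (hdis i j)
  choose f₁ hf₁ using hinl
  have hleg : IsLeg G₁ v₁ f₁ := by
    refine ⟨fun i j hij => hf.inj (by rw [← hf₁, ← hf₁, hij]), fun i hi => ?_, fun i z => ?_⟩
    · exact hf.ne_base i (by rw [← hf₁, hi, h1])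
    · rw [← attachPath_inl_inl (G := G₁) (v := v₁) (k := l), ← e.map_adj_iff, hf₁, hf.adj_iff]
      have h3 : e (.inl z) = w ↔ z = v₁ := by
        rw [← h1, e.injective.eq_iff, Sum.inl.injEq]
      have h4 : ∀ j, e (.inl z) = f j ↔ z = f₁ j := by
        intro j
        rw [← hf₁, e.injective.eq_iff, Sum.inl.injEq]
      simp only [h3, h4]
  obtain ⟨W, hW, G, v, e', h3, h4⟩ := hleg.peel
  refine ⟨W, hW, G, v, (attachCongr e' (.inl v) l).trans (h3 ▸ e : attachPath G₁ (e' (.inl v)) l ≃g T),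
    hk, hl, ?_⟩
  subst h3
  refine ⟨h1, ?_, h2 _⟩
  rw [← hf₁, ← h4]
  rfl

/-- The last four vertices of a leg with six vertices. -/
theorem IsLeg.tail {w : V} {f : Fin 6 → V} (h : IsLeg T w f) :
    IsLeg T (f 1) (fun i : Fin 4 => f ⟨i.val + 2, by omega⟩) := by
  refine ⟨fun i j hij => ?_, fun i hi => ?_, fun i z => ?_⟩
  · have := h.inj hij
    rw [Fin.mk.injEq] at this
    ext
    omega
  · have := h.inj hi
    rw [Fin.ext_iff] at this
    simp at this
  · rw [h.adj_iff]
    constructor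
    · rintro (⟨j, rfl, hj⟩ | ⟨h0, -⟩)
      · simp only at hj
        by_cases hj2 : 2 ≤ j.val
        · refine Or.inl ⟨⟨j.val - 2, by omega⟩, ?_, ?_⟩
          · congr 1
            ext
            simp only
            omega
          · simp only
            omega
        · refine Or.inr ⟨by omega, ?_⟩
          congr 1
          ext
          simp
          omega
      · simp at h0
    · rintro (⟨j, rfl, hj⟩ | ⟨h0, rfl⟩)
      · exact Or.inl ⟨_, rfl, by simp only; omega⟩
      · exact Or.inl ⟨1, rfl, by simp [h0]⟩

end legs

/-! ### The bound for all trees -/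

/-! ### Base case: paths with two to six vertices -/

section single

variable {W : Type u} [Subsingleton W] {G : SimpleGraph W} {v : W} {k : ℕ}

theorem isLeaf_inl_of_subsingleton (hk : 1 ≤ k) : IsLeaf (attachPath G v k) (.inl v) := by
  rw [isLeaf_iff]
  refine ⟨.inr ⟨0, hk⟩, by simp, ?_⟩
  rintro (a | i) h
  · exact absurd (Subsingleton.elim v a) (attachPath_inl_inl.1 h).ne
  · rw [attachPath_inl_inr] at h
    congr 1
    ext
    exact h.2

theorem isSupport_zero_of_subsingleton (hk : 1 ≤ k) :
    IsSupport (attachPath G v k) (.inr ⟨0, hk⟩) :=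
  ⟨.inl v, by simp, isLeaf_inl_of_subsingleton hk⟩

variable [Finite W]

theorem two_le_numLeaves_of_subsingleton (hk : 1 ≤ k) : 2 ≤ numLeaves (attachPath G v k) := by
  have : {.inl v, .inr ⟨k - 1, by omega⟩} ⊆ {x | IsLeaf (attachPath G v k) x} := by
    rintro x (rfl | rfl)
    · exact isLeaf_inl_of_subsingleton hk
    · exact (isLeaf_inr_iff _).2 (by simp only; omega)
  have h := Set.ncard_le_ncard this
  rwa [Set.ncard_pair (by simp)] at h

theorem le_weight_of_subsingleton (hk : 1 ≤ k) : k + 4 ≤ weight (attachPath G v k) := by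
  have h1 := two_le_numLeaves_of_subsingleton (G := G) (v := v) hk
  have h2 : 0 < numSupports (attachPath G v k) :=
    (Set.ncard_pos).2 ⟨_, isSupport_zero_of_subsingleton hk⟩
  have h3 : 0 < Nat.card W := Nat.card_pos_iff.2 ⟨⟨v⟩, inferInstance⟩
  unfold weight
  rw [card_attach]
  omega

/-- From k = 3 on, the neighbours of the two endpoints are different supports. -/
theorem le_weight_of_subsingleton' (hk : 3 ≤ k) : k + 5 ≤ weight (attachPath G v k) := by
  have h1 := two_le_numLeaves_of_subsingleton (G := G) (v := v) (k := k) (by omega)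
  have h2 : 2 ≤ numSupports (attachPath G v k) := by
    have : {.inr ⟨0, by omega⟩, .inr ⟨k - 2, by omega⟩} ⊆
        {x | IsSupport (attachPath G v k) x} := by
      rintro x (rfl | rfl)
      · exact isSupport_zero_of_subsingleton (by omega)
      · refine ⟨.inr ⟨k - 1, by omega⟩, ?_, (isLeaf_inr_iff _).2 (by simp only; omega)⟩
        rw [attachPath_inr_inr]
        exact Or.inl (by simp only; omega)
    have h := Set.ncard_le_ncard this
    rwa [Set.ncard_pair (by simp; omega)] at h
  have h3 : 0 < Nat.card W := Nat.card_pos_iff.2 ⟨⟨v⟩, inferInstance⟩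
  unfold weight
  rw [card_attach]
  omega

/-- For k = 3 the decomposition has the two middle vertices as ends; all other lengths are strict.
-/
theorem bound_of_subsingleton (hk : 1 ≤ k) (hk' : k ≤ 5) : Bound (attachPath G v k) := by
  have hv : ∀ a : W, a = v := fun a => Subsingleton.elim _ _
  have huniv : ∀ a : W, Dominated G {v} a := fun a => Or.inl (hv a)
  have hempty : ∀ {F : Set (Fin k)}, Dominated (attachPath G v k) (extend ∅ F) (.inl v) →
      (∀ i, Dominated (attachPath G v k) (extend ∅ F) (.inr i)) →
      ∀ x, Dominated (attachPath G v k) (extend ∅ F) x := by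
    rintro F h1 h2 (a | i)
    · rw [hv a]; exact h1
    · exact h2 i
  have hw := le_weight_of_subsingleton (G := G) (v := v) hk
  have hs : ({v} : Set W).ncard = 1 := Set.ncard_singleton v
  have hcard := ncard_extend_singleton_le ({v} : Set W) (k := k)
  have hcard' := ncard_extend_singleton_le (∅ : Set W) (k := k)
  rw [Set.ncard_empty] at hcard'
  interval_cases k
  · refine Bound.of_lt (D := extend ∅ {0}) (hempty ?_ fun i => ?_) ?_
    · exact Or.inr (Or.inl ⟨.inr 0, by simp, by simp⟩)
    · exact Or.inl (inr_mem_extend.2 (Subsingleton.elim i 0))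
    · have := hcard' 0; omega
  · refine Bound.of_lt (D := extend ∅ {0}) (hempty ?_ fun i => ?_) ?_
    · exact Or.inr (Or.inl ⟨.inr 0, by simp, by simp⟩)
    · fin_cases i
      · exact Or.inl (by simp)
      · exact Or.inr (Or.inl ⟨.inr 0, by simp, by simp⟩)
    · have := hcard' 0; omega
  · have h1 := disjDomNumber_le (dominated_extend_three (v := v) huniv)
    have h2 := hcard 1
    have h3 := le_weight_of_subsingleton' (G := G) (v := v) (k := 3) le_rfl
    refine ⟨by omega, fun _ => ⟨extend ∅ {0, 1}, ?_⟩⟩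
    have hG : ∀ a b : W, ¬ G.Adj a b := fun a b h => h.ne (Subsingleton.elim _ _)
    refine ⟨?_, ?_, ?_, ?_, ?_, ?_⟩
    · rintro (e | i) he
      · simp at he
      · simp only [inr_mem_extend, Set.mem_insert_iff, Set.mem_singleton_iff] at he
        rcases he with rfl | rfl
        · exact ⟨.inl v, by simp, by simp⟩
        · exact ⟨.inr 2, by simp, by simp⟩
    · rintro (e | i) he (c | j) (c' | j') hc hc' h1 h2 <;>
        simp only [inl_mem_extend, inr_mem_extend, Set.mem_singleton_iff,
          attachPath_inr_inl, attachPath_inr_inr, Sum.inl.injEq,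
          Sum.inr.injEq, Set.mem_insert_iff, Set.mem_empty_iff_false] at * <;> grind
    · rintro (e | i) he
      · exact ⟨.inr 0, by simp, by simp [hv e]⟩
      · simp only [inr_mem_extend, Set.mem_insert_iff, Set.mem_singleton_iff] at he
        refine ⟨.inr 1, by simp, ?_⟩
        have : i = 2 := by omega
        simp [this]
    · rintro (e | i) he (c | j) hc (c' | j') hc' h1 h2 <;>
        simp only [inl_mem_extend, inr_mem_extend, Set.mem_singleton_iff,
          attachPath_inl_inr, attachPath_inr_inr,
          Sum.inr.injEq, Set.mem_insert_iff, Set.mem_empty_iff_false] at * <;> grind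
    · rintro (e | i) (c | j) (c' | j') he hc hc' h1 h2 <;>
        simp only [inl_mem_extend, inr_mem_extend, Set.mem_singleton_iff, attachPath_inl_inl,
          attachPath_inl_inr, attachPath_inr_inl, attachPath_inr_inr, Sum.inl.injEq,
          Sum.inr.injEq, Set.mem_insert_iff, Set.mem_empty_iff_false] at * <;> grind
    · rintro (e | i) he
      · simp at he
      · simp only [inr_mem_extend, Set.mem_insert_iff, Set.mem_singleton_iff] at he
        rcases he with rfl | rfl
        · exact ⟨.inr 1, by simp, by simp⟩
        · exact ⟨.inr 0, by simp, by simp⟩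
  · refine Bound.of_lt (dominated_extend_four huniv (Or.inl rfl)) ?_
    have h2 := hcard 2
    have h3 := le_weight_of_subsingleton' (G := G) (v := v) (k := 4) (by omega)
    omega
  · refine Bound.of_lt (dominated_extend_five huniv rfl) ?_
    have h2 := hcard 3
    omega

end single

/-- All trees with fewer than `n` but at least two vertices satisfy the bound. -/
def BoundBelow (n : ℕ) : Prop :=
  ∀ (W : Type u) [Finite W] [Nontrivial W] (G : SimpleGraph W), G.IsTree → Nat.card W < n → Bound G

/-! ### The minimal counterexample -/

section step

variable {V : Type u} {T : SimpleGraph V}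

theorem card_of_iso {W : Type u} [Finite W] {G : SimpleGraph W} {v : W} {k : ℕ}
    (e : attachPath G v k ≃g T) : Nat.card V = Nat.card W + k := by
  rw [← card_attach, Nat.card_congr e.toEquiv]

theorem dominated_image_iso {W : Type u} {G : SimpleGraph W} (e : G ≃g T) {D : Set W}
    (hD : ∀ a, Dominated G D a) (x : V) : Dominated T (e '' D) x := by
  have := (hD (e.symm x)).map (H := T) e e.injective (fun a b h => e.map_adj_iff.2 h)
    (D' := e '' D) (fun a ha => ⟨a, ha, rfl⟩)
  simpa using this

variable [Finite V]

theorem bound_of_leg_two_or_three (hT : T.IsTree) (IH : BoundBelow.{u} (Nat.card V)) {w x y z : V}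
    {k : ℕ} (hk : k = 2 ∨ k = 3) (h : HasLeg T w x k) (hy : T.Adj w y) (hz : T.Adj w z)
    (hyx : y ≠ x) (hzx : z ≠ x) (hyz : y ≠ z) : Bound T := by
  obtain ⟨W, hW, G, v, e, hk0, rfl, rfl⟩ := h.peel
  have hG : G.IsTree := isTree_of_attachPath (e.isTree_iff.2 hT)
  have pull : ∀ t, T.Adj (e (.inl v)) t → t ≠ e (.inr ⟨0, hk0⟩) → ∃ a, G.Adj v a ∧ e (.inl a) = t := by
    intro t ht hne
    obtain ⟨a | i, rfl⟩ := e.surjective t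
    · exact ⟨a, e.map_adj_iff.1 ht, rfl⟩
    · have h1 := e.map_adj_iff.1 ht
      rw [attachPath_inl_inr] at h1
      exact absurd (congrArg (fun i => e (.inr i)) (Fin.ext h1.2)) hne
  obtain ⟨a, ha, rfl⟩ := pull y hy hyx
  obtain ⟨b, hb, rfl⟩ := pull z hz hzx
  have hbr : Branching G v := ⟨a, b, fun hc => hyz (by rw [hc]), ha, hb⟩
  have : Nontrivial W := ⟨v, a, ha.ne⟩
  have hB : Bound G := IH W G hG (by rw [card_of_iso e]; omega)
  rcases hk with rfl | rfl
  · exact (bound_attach_two hG hbr hB).iso e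
  · exact (bound_attach_three hbr hB).iso e

/-- Deleting the last four vertices leaves the leaf `f 1`, whose neighbour `f 0` has only `w`
besides it, as `bound_attach_four` requires. -/
theorem bound_of_leg_six (hT : T.IsTree) (IH : BoundBelow.{u} (Nat.card V)) {w x : V}
    (h : HasLeg T w x 6) : Bound T := by
  obtain ⟨f, hf, -, -⟩ := h
  obtain ⟨W, hW, G, v, e, h1, h2⟩ := hf.tail.peel
  have hG : G.IsTree := isTree_of_attachPath (e.isTree_iff.2 hT)
  have pull : ∀ t, (∀ i : Fin 4, t ≠ f ⟨i.val + 2, by omega⟩) → ∃ a, e (.inl a) = t := by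
    intro t ht
    obtain ⟨a | i, rfl⟩ := e.surjective t
    · exact ⟨a, rfl⟩
    · exact absurd (h2 i) (ht i)
  obtain ⟨u, hu⟩ := pull (f 0) (fun i hc => by
    have : 0 = i.val + 2 := congrArg Fin.val (hf.inj hc)
    omega)
  obtain ⟨y, hy⟩ := pull w (fun i hc => hf.ne_base _ hc.symm)
  have hadj : ∀ {a b}, G.Adj a b ↔ T.Adj (e (.inl a)) (e (.inl b)) := by
    intro a b
    rw [e.map_adj_iff, attachPath_inl_inl]
  have hne : ∀ (a : W) (i : Fin 4), e (.inl a) ≠ f ⟨i.val + 2, by omega⟩ := by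
    intro a i hc
    rw [← h2 i, e.injective.eq_iff] at hc
    cases hc
  have hvu : G.Adj v u := by
    rw [hadj, h1, hu, hf.adj_iff]
    exact Or.inl ⟨0, rfl, by simp⟩
  have hleaf : IsLeaf G v := by
    refine isLeaf_iff.2 ⟨u, hvu, fun a ha => ?_⟩
    rw [hadj, h1, hf.adj_iff] at ha
    rcases ha with ⟨j, hj, hj' | hj'⟩ | ⟨h0, -⟩
    · exact absurd (hj.trans (congrArg f (Fin.ext (by simpa using hj'.symm)))) (hne a 0)
    · have : j = 0 := Fin.ext (by simpa using hj')
      rw [this, ← hu, e.injective.eq_iff] at hj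
      exact Sum.inl_injective hj
    · simp at h0
  have hu2 : ∀ a, G.Adj u a → a = v ∨ a = y := by
    intro a ha
    rw [hadj, hu, hf.adj_iff] at ha
    rcases ha with ⟨j, hj, hj' | hj'⟩ | ⟨-, h0⟩
    · left
      have : j = 1 := Fin.ext (by simpa using hj'.symm)
      rw [this, ← h1, e.injective.eq_iff] at hj
      exact Sum.inl_injective hj
    · simp at hj'
    · right
      rw [← hy, e.injective.eq_iff] at h0
      exact Sum.inl_injective h0
  have : Nontrivial W := ⟨v, u, hvu.ne⟩
  have hB : Bound G := IH W G hG (by rw [card_of_iso e]; omega)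
  exact (bound_attach_four hleaf hvu hu2 hB).iso e

/-- A cheap dominating set through a given leaf. -/
theorem exists_dominating_mem_leaf (hT : T.IsTree) (IH : BoundBelow.{u} (Nat.card V)) {w : V}
    (hw : IsLeaf T w) :
    ∃ D : Set V, (∀ a, Dominated T D a) ∧ w ∈ D ∧ 4 * D.ncard ≤ weight T + 2 := by
  obtain ⟨z, hwz, hz⟩ := isLeaf_iff.1 hw
  have hleg : HasLeg T z w 1 := HasLeg.one hwz.symm hz
  obtain ⟨W, hW, G, v, e, hk₁, he, hew⟩ := hleg.peel
  have hG : G.IsTree := isTree_of_attachPath (e.isTree_iff.2 hT)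
  rcases subsingleton_or_nontrivial W with hs | hn
  · refine ⟨{w}, fun a => ?_, rfl, ?_⟩
    · obtain ⟨b | i, rfl⟩ := e.surjective a
      · rw [Subsingleton.elim b v, he]
        exact Or.inr (Or.inl ⟨w, rfl, hwz.symm⟩)
      · rw [← hew]
        exact Or.inl (congrArg (fun i => e (.inr i)) (Subsingleton.elim _ _))
    · rw [weight_iso e, Set.ncard_singleton]
      have := le_weight_of_subsingleton (G := G) (v := v) (le_refl 1)
      omega
  -- If the support of `w` still branches without `w`, deleting `w` lowers the weight by at least 2
  -- and adding `w` back costs 4. Otherwise the support is deleted too; `w` dominates it, and the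
  -- weight again drops by at least 2.
  rcases branching_or_isLeaf hG v with hv | hv
  · have hB : Bound G := IH W G hG (by rw [card_of_iso e]; omega)
    obtain ⟨D, hD, hc⟩ := hB.exists_dominating
    refine ⟨e '' extend D {0}, dominated_image_iso e ?_, ⟨.inr 0, by simp, hew⟩, ?_⟩
    · exact dominated_extend hD fun i => Or.inl (inr_mem_extend.2 (Subsingleton.elim i 0))
    · rw [Set.ncard_image_of_injective _ e.injective, weight_iso e]
      have h1 := ncard_extend_singleton_le D (0 : Fin 1)
      have h2 := weight_attachPath_one_of_branching hv
      omega
  · obtain ⟨p, hvp, hp⟩ := isLeaf_iff.1 hv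
    have hzp : T.Adj (e (.inl p)) z := by
      rw [← he, e.map_adj_iff]
      exact hvp.symm
    have hleg2 : HasLeg T (e (.inl p)) z 2 := by
      refine hleg.cons hzp ?_ ?_
      · intro hc
        rw [← hew, e.injective.eq_iff] at hc
        cases hc
      · intro t ht
        obtain ⟨a | i, rfl⟩ := e.surjective t
        · left
          rw [← he, e.map_adj_iff] at ht
          rw [hp a ht]
        · right
          rw [← hew]
          exact congrArg (fun i => e (.inr i)) (Subsingleton.elim _ _)
    obtain ⟨W', hW', G', v', e', hk₂, he', hez'⟩ := hleg2.peel
    have hG' : G'.IsTree := isTree_of_attachPath (e'.isTree_iff.2 hT)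
    have hew' : e' (.inr 1) = w := by
      have : T.Adj z (e' (.inr 1)) := by
        rw [← hez', e'.map_adj_iff]
        simp
      obtain ⟨t, ht⟩ := e'.surjective w
      have h2 : T.Adj z w := hwz.symm
      rw [← ht, ← hez', e'.map_adj_iff] at h2
      rcases t with a | i
      · exfalso
        rw [attachPath_inr_inl] at h2
        rw [h2.1, he'] at ht
        rw [← hew, e.injective.eq_iff] at ht
        cases ht
      · rw [attachPath_inr_inr] at h2
        rw [← ht]
        congr 2
        ext
        simp at h2 ⊢
        omega
    have hdom : ∀ {D : Set W'}, (∀ a, Dominated G' D a) →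
        ∀ x, Dominated (attachPath G' v' 2) (extend D {1}) x := by
      intro D hD
      refine dominated_extend hD fun i => ?_
      fin_cases i
      · exact Or.inr (Or.inl ⟨.inr 1, by simp, by simp⟩)
      · exact Or.inl (by simp)
    rcases subsingleton_or_nontrivial W' with hs | hn
    · refine ⟨e' '' extend {v'} {1}, dominated_image_iso e' (hdom fun a => Or.inl ?_),
        ⟨.inr 1, by simp, hew'⟩, ?_⟩
      · exact Subsingleton.elim _ _
      · rw [Set.ncard_image_of_injective _ e'.injective, weight_iso e']
        have h1 := ncard_extend_singleton_le {v'} (1 : Fin 2)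
        have h2 := le_weight_of_subsingleton (G := G') (v := v') (k := 2) (by omega)
        rw [Set.ncard_singleton] at h1
        omega
    · have hB : Bound G' := IH W' G' hG' (by rw [card_of_iso e']; omega)
      obtain ⟨D, hD, hc⟩ := hB.exists_dominating
      refine ⟨e' '' extend D {1}, dominated_image_iso e' (hdom hD), ⟨.inr 1, by simp, hew'⟩, ?_⟩
      rw [Set.ncard_image_of_injective _ e'.injective, weight_iso e']
      have h1 := ncard_extend_singleton_le D (1 : Fin 2)
      have h2 : weight G' + 2 ≤ weight (attachPath G' v' 2) := by
        rcases branching_or_isLeaf hG' v' with hv | hv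
        · have := weight_attachPath_of_branching hv (le_refl 2)
          omega
        · exact weight_attachPath_of_isLeaf hv (le_refl 2)
      omega

theorem bound_of_two_legs (hT : T.IsTree) (IH : BoundBelow.{u} (Nat.card V)) {w x y z : V}
    {k l : ℕ} (hx : HasLeg T w x k) (hy : HasLeg T w y l) (hxy : x ≠ y) (hz : T.Adj w z)
    (hzx : z ≠ x) (hzy : z ≠ y)
    (hkl : (k = 1 ∧ l = 1) ∨ (k = 1 ∧ l = 4) ∨ (k = 4 ∧ l = 4) ∨ (k = 5 ∧ l = 5) ∨
      (k = 5 ∧ (l = 1 ∨ l = 4) ∧ ∀ t, T.Adj w t → t = x ∨ t = y ∨ t = z)) : Bound T := by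
  obtain ⟨W, hW, G, v, e, hk, hl, rfl, rfl, rfl⟩ := hx.peel_two hy hxy
  have hG₁ : (attachPath G v k).IsTree := isTree_of_attachPath (e.isTree_iff.2 hT)
  have hG : G.IsTree := isTree_of_attachPath hG₁
  have hcard : Nat.card V = Nat.card W + k + l := by
    rw [card_of_iso e, card_attach]
  obtain ⟨a, hva, rfl⟩ : ∃ a, G.Adj v a ∧ e (.inl (.inl a)) = z := by
    obtain ⟨(a | i) | i, rfl⟩ := e.surjective z
    · exact ⟨a, e.map_adj_iff.1 hz, rfl⟩
    · have h1 := e.map_adj_iff.1 hz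
      rw [attachPath_inl_inl, attachPath_inl_inr] at h1
      exact absurd (congrArg (fun i => e (.inl (.inr i))) (Fin.ext h1.2)) hzx
    · have h1 := e.map_adj_iff.1 hz
      rw [attachPath_inl_inr] at h1
      exact absurd (congrArg (fun i => e (.inr i)) (Fin.ext h1.2)) hzy
  have hv : ∃ a, G.Adj v a := ⟨a, hva⟩
  have : Nontrivial W := ⟨v, a, hva.ne⟩
  have hB : Bound G := IH W G hG (by omega)
  -- Replacing both legs by a single pendant leaf still gives a smaller tree.
  have hH : k + l ≥ 2 → Bound (attachPath G v 1) := by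
    intro _
    have : Nontrivial (W ⊕ Fin 1) := ⟨.inl v, .inr 0, by simp⟩
    exact IH (W ⊕ Fin 1) _ (attachPath_isTree_of_le hG₁ hk) (by rw [card_attach]; omega)
  have hleaf : IsLeaf G v → (k = 5 ∧ (l = 1 ∨ l = 4 ∨ l = 5)) → Bound T := by
    rintro hv ⟨rfl, hl⟩
    obtain ⟨D, hD, hvD, hc⟩ := exists_dominating_mem_leaf hG
      (fun W' _ _ G' hG' hlt => IH W' G' hG' (by omega)) hv
    exact (bound_attach_five_of_isLeaf hv hD hvD hc hl).iso e
  rcases hkl with ⟨rfl, rfl⟩ | ⟨rfl, rfl⟩ | ⟨rfl, rfl⟩ | ⟨rfl, rfl⟩ | ⟨rfl, hl', hall⟩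
  · exact (bound_attach_one_one hv (hH (by omega))).iso e
  · exact (bound_attach_one_four hv (hH (by omega))).iso e
  · exact (bound_attach_four_four hv (hH (by omega))).iso e
  · rcases branching_or_isLeaf hG v with h | h
    · exact (bound_attach_five_five h hB).iso e
    · exact hleaf h (by omega)
  · refine hleaf (isLeaf_iff.2 ⟨a, hva, fun b hb => ?_⟩) (by omega)
    rcases hall (e (.inl (.inl b))) (e.map_adj_iff.2 hb) with h | h | h
    · have := e.injective h
      simp at this
    · have := e.injective h
      simp at this
    · have := e.injective h
      simpa using this

/-- In a counterexample rooted at a leaf, the reductions exclude every branching, so the tree is a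
path, and a short one. -/
theorem bound_step [Nontrivial V] (hT : T.IsTree) (IH : BoundBelow.{u} (Nat.card V)) : Bound T := by
  by_contra hcon
  obtain ⟨r, hr⟩ : ∃ r, IsLeaf T r := by
    classical
    cases nonempty_fintype V
    obtain ⟨r, hr⟩ := hT.exists_vert_degree_one_of_nontrivial
    refine ⟨r, isLeaf_iff.2 ?_⟩
    obtain ⟨w, hw, h⟩ := SimpleGraph.degree_eq_one_iff_existsUnique_adj.1 hr
    exact ⟨w, hw, h⟩
  obtain ⟨M, hM⟩ : ∃ M, ∀ x, T.dist r x ≤ M := by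
    obtain ⟨M, hM⟩ := (Set.finite_range (T.dist r)).bddAbove
    exact ⟨M, fun x => hM ⟨x, rfl⟩⟩
  -- Everything from `x` downwards is a path with at most five vertices. The induction is on the
  -- room left below `x`, since children are farther from `r`.
  have claim : ∀ (m : ℕ) (p x : V), T.Adj x p → T.dist r x = T.dist r p + 1 →
      M - T.dist r x ≤ m → ∃ k, 1 ≤ k ∧ k ≤ 5 ∧ HasLeg T p x k := by
    intro m
    induction m using Nat.strong_induction_on with
    | _ m ih =>
    intro p x hxp hd hm
    have hchild : ∀ y, T.Adj x y → y ≠ p → ∃ k, 1 ≤ k ∧ k ≤ 5 ∧ HasLeg T x y k := by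
      intro y hxy hyp
      have h1 := dist_child hT r hxp hd hxy hyp
      have h2 := hM y
      exact ih (M - T.dist r y) (by omega) x y hxy.symm h1 le_rfl
    have hnot : ∀ y z k, T.Adj x y → T.Adj x z → y ≠ p → z ≠ p → y ≠ z → HasLeg T x y k →
        k ≠ 2 ∧ k ≠ 3 := by
      intro y z k _ hxz hyp hzp hyz hleg
      have := fun hk => hcon (bound_of_leg_two_or_three hT IH hk hleg hxp hxz (Ne.symm hyp)
        hyz.symm (Ne.symm hzp))
      tauto
    -- two legs below `x` have lengths `5` and `1` or `4`, and there is a fourth neighbour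
    have hpair : ∀ y z k l, T.Adj x y → T.Adj x z → y ≠ p → z ≠ p → y ≠ z → k ≤ 5 → l ≤ 5 →
        1 ≤ k → 1 ≤ l → HasLeg T x y k → HasLeg T x z l →
        ((k = 5 ∧ (l = 1 ∨ l = 4)) ∨ (l = 5 ∧ (k = 1 ∨ k = 4))) ∧
          ∃ t, T.Adj x t ∧ t ≠ p ∧ t ≠ y ∧ t ≠ z := by
      intro y z k l hxy hxz hyp hzp hyz hk hl hk1 hl1 hky hlz
      have h1 := hnot y z k hxy hxz hyp hzp hyz hky
      have h2 := hnot z y l hxz hxy hzp hyp hyz.symm hlz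
      have h3 := fun h => hcon (bound_of_two_legs hT IH hky hlz hyz hxp (Ne.symm hyp)
        (Ne.symm hzp) h)
      have h4 := fun h => hcon (bound_of_two_legs hT IH hlz hky hyz.symm hxp (Ne.symm hzp)
        (Ne.symm hyp) h)
      have h5 : (k = 5 ∧ (l = 1 ∨ l = 4)) ∨ (l = 5 ∧ (k = 1 ∨ k = 4)) := by
        by_contra h6
        by_cases hlt : k ≤ l
        · have h7 : (k = 1 ∧ l = 1) ∨ (k = 1 ∧ l = 4) ∨ (k = 4 ∧ l = 4) ∨ (k = 5 ∧ l = 5) := by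
            clear h3 h4
            omega
          rcases h7 with h7 | h7 | h7 | h7
          · exact h3 (Or.inl h7)
          · exact h3 (Or.inr (Or.inl h7))
          · exact h3 (Or.inr (Or.inr (Or.inl h7)))
          · exact h3 (Or.inr (Or.inr (Or.inr (Or.inl h7))))
        · have h7 : l = 1 ∧ k = 4 := by
            clear h3 h4
            omega
          exact h4 (Or.inr (Or.inl h7))
      refine ⟨h5, ?_⟩
      by_contra hno
      push Not at hno
      rcases h5 with ⟨hk5, hl5⟩ | ⟨hl5, hk5⟩
      · exact h3 (Or.inr (Or.inr (Or.inr (Or.inr ⟨hk5, hl5, fun t ht => by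
          have := hno t ht; tauto⟩))))
      · exact h4 (Or.inr (Or.inr (Or.inr (Or.inr ⟨hl5, hk5, fun t ht => by
          have := hno t ht; tauto⟩))))
    by_cases h0 : ∀ y, T.Adj x y → y = p
    · exact ⟨1, le_rfl, by omega, HasLeg.one hxp.symm h0⟩
    push Not at h0
    obtain ⟨y, hxy, hyp⟩ := h0
    obtain ⟨k, hk1, hk5, hky⟩ := hchild y hxy hyp
    by_cases h1 : ∀ z, T.Adj x z → z = p ∨ z = y
    · have hleg := hky.cons hxp.symm (Ne.symm hyp) h1
      refine ⟨k + 1, by omega, ?_, hleg⟩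
      by_contra hk
      obtain rfl : k = 5 := by omega
      exact hcon (bound_of_leg_six hT IH hleg)
    · exfalso
      push Not at h1
      obtain ⟨z, hxz, hzp, hzy⟩ := h1
      obtain ⟨l, hl1, hl5, hlz⟩ := hchild z hxz hzp
      obtain ⟨h2, t, hxt, htp, hty, htz⟩ :=
        hpair y z k l hxy hxz hyp hzp (Ne.symm hzy) hk5 hl5 hk1 hl1 hky hlz
      -- Each pair among the three legs at `y`, `z`, `t` would contain exactly one of length 5,
      -- which is impossible.
      obtain ⟨m', hm1, hm5, hmt⟩ := hchild t hxt htp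
      have h3 := (hpair y t k m' hxy hxt hyp htp (Ne.symm hty) hk5 hm5 hk1 hm1 hky hmt).1
      have h4 := (hpair z t l m' hxz hxt hzp htp (Ne.symm htz) hl5 hm5 hl1 hm1 hlz hmt).1
      omega
  obtain ⟨x, hrx, hx⟩ := isLeaf_iff.1 hr
  have hd : T.dist r x = T.dist r r + 1 := by
    rw [SimpleGraph.dist_self, SimpleGraph.dist_eq_one_iff_adj.2 hrx]
  obtain ⟨k, hk1, hk5, hleg⟩ := claim _ r x hrx.symm hd le_rfl
  obtain ⟨W, hW, G, v, e, hk0, he, hex⟩ := hleg.peel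
  have hG : G.IsTree := isTree_of_attachPath (e.isTree_iff.2 hT)
  -- The root is a leaf, so the leg at its only neighbour is all the rest; a further vertex in `W`
  -- would give `r` a second neighbour.
  rcases subsingleton_or_nontrivial W with hs | hn
  · exact hcon ((bound_of_subsingleton hk1 hk5).iso e)
  · obtain ⟨a, ha⟩ := exists_adj_of_tree hG v
    have h1 : T.Adj r (e (.inl a)) := by
      rw [← he, e.map_adj_iff]
      exact ha
    have h2 := hx _ h1
    rw [← hex, e.injective.eq_iff] at h2
    cases h2

end step

theorem bound_of_isTree {V : Type u} [Finite V] [Nontrivial V] {T : SimpleGraph V}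
    (hT : T.IsTree) : Bound T := by
  have key : ∀ n, BoundBelow.{u} n := by
    intro n
    induction n with
    | zero => exact fun W _ _ G _ h => absurd h (by omega)
    | succ n ih =>
      intro W _ _ G hG hlt
      exact bound_step hG fun W' _ _ G' hG' hlt' => ih W' G' hG' (by omega)
  exact key _ V T hT (Nat.lt_succ_self _)

/-! ### Labelings of decomposed trees -/

/-- The labeling `S` is compatible with the decomposition with set of ends `E`. -/
structure Labeled {V : Type u} (G : SimpleGraph V) (S : V → Status) (E : Set V) : Prop where
  leaf : ∀ e ∈ E, ∀ c, c ∉ E → G.Adj e c → (∀ d, d ∉ E → ¬ G.Adj c d) → S e = .A ∧ S c = .C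
  link : ∀ e ∈ E, ∀ e' ∈ E, ∀ c d, c ∉ E → d ∉ E → G.Adj e c → G.Adj c d → G.Adj d e' →
    (S e = .A ∧ S c = .C ∧ S d = .D ∧ S e' = .B) ∨ (S e = .B ∧ S c = .D ∧ S d = .C ∧ S e' = .A)

theorem SmallEnd.iso {V : Type u} {W : Type w} {G : SimpleGraph V} {H : SimpleGraph W}
    (e : G ≃g H) {E : Set V} {x : W} (h : SmallEnd G E (e.symm x)) :
    SmallEnd H (e.symm ⁻¹' E) x :=
  fun _ ha _ hb hxa hxb => e.symm.injective
    (h _ ha _ hb (e.symm.map_adj_iff.2 hxa) (e.symm.map_adj_iff.2 hxb))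

theorem Tight.iso {V : Type u} {W : Type w} {G : SimpleGraph V} {H : SimpleGraph W}
    (e : G ≃g H) {E : Set V} (h : Tight G E) : Tight H (e.symm ⁻¹' E) := by
  have ha : ∀ {a b}, H.Adj a b → G.Adj (e.symm a) (e.symm b) := fun {a b} hab =>
    e.symm.map_adj_iff.2 hab
  refine ⟨h.toPieces.iso e, ?_, ?_⟩
  · intro x hx c hc hxc hd
    refine (h.small_of_leaf _ hx _ hc (ha hxc) fun d hdE hcd => ?_).iso e
    refine hd (e d) (by simpa using hdE) ?_
    rw [← e.symm.map_adj_iff]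
    simpa using hcd
  · intro x hx x' hx' c d hc hd h1 h2 h3
    exact (h.small_of_link _ hx _ hx' _ _ hc hd (ha h1) (ha h2) (ha h3)).imp
      (SmallEnd.iso e) (SmallEnd.iso e)

theorem Labeled.iso {V : Type u} {W : Type w} {G : SimpleGraph V} {H : SimpleGraph W}
    (e : G ≃g H) {S : V → Status} {E : Set V} (h : Labeled G S E) :
    Labeled H (fun x => S (e.symm x)) (e.symm ⁻¹' E) := by
  have ha : ∀ {a b}, H.Adj a b → G.Adj (e.symm a) (e.symm b) := fun {a b} hab =>
    e.symm.map_adj_iff.2 hab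
  refine ⟨?_, ?_⟩
  · intro x hx c hc hxc hd
    refine h.leaf _ hx _ hc (ha hxc) fun d hdE hcd => ?_
    refine hd (e d) (by simpa using hdE) ?_
    rw [← e.symm.map_adj_iff]
    simpa using hcd
  · intro x hx x' hx' c d hc hd h1 h2 h3
    exact h.link _ hx _ hx' _ _ hc hd (ha h1) (ha h2) (ha h3)

/-- The decomposition of the path with four vertices into two pieces. -/
theorem tight_pathGraph_four : Tight (SimpleGraph.pathGraph 4) {1, 2} := by
  refine ⟨⟨?_, ?_, ?_, ?_, ?_, ?_⟩, ?_, ?_⟩ <;>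
    simp only [SmallEnd, Set.mem_insert_iff, Set.mem_singleton_iff, SimpleGraph.pathGraph_adj]
  · decide
  · intros; omega
  · decide
  · intros; omega
  · intros; omega
  · decide
  · intros; omega
  · intros; omega

theorem labeled_pathGraph_four :
    Labeled (SimpleGraph.pathGraph 4) ![Status.C, .A, .A, .C] {1, 2} := by
  refine ⟨?_, ?_⟩
  · intro e he c hc hec hd
    simp only [Set.mem_insert_iff, Set.mem_singleton_iff, SimpleGraph.pathGraph_adj] at *
    fin_cases e <;> fin_cases c <;> simp_all
  · intro e he e' he' c d hc hd h1 h2 h3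
    exfalso
    simp only [Set.mem_insert_iff, Set.mem_singleton_iff, SimpleGraph.pathGraph_adj] at *
    omega

section label

variable {V : Type u} {G : SimpleGraph V} {S : V → Status} {E : Set V} {v : V}

/-- The two possibilities for an inner vertex and its end. -/
theorem Labeled.cases (h : Labeled G S E) (hP : Pieces G E) {e c : V} (he : e ∈ E) (hc : c ∉ E)
    (hec : G.Adj e c) : (S e = .A ∧ S c = .C) ∨ (S e = .B ∧ S c = .D) := by
  by_cases hd : ∀ d, d ∉ E → ¬ G.Adj c d
  · exact Or.inl (h.leaf e he c hc hec hd)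
  · push Not at hd
    obtain ⟨d, hd, hcd⟩ := hd
    obtain ⟨e', he', hde'⟩ := hP.exists_end d hd
    rcases h.link e he e' he' c d hc hd hec hcd hde' with h1 | h1
    · exact Or.inl ⟨h1.1, h1.2.1⟩
    · exact Or.inr ⟨h1.1, h1.2.1⟩

/-- The statuses determine the ends, which lets the operations, stated by status, be read in terms
of pieces. -/
theorem Labeled.mem_iff (h : Labeled G S E) (hP : Pieces G E) {x : V} :
    x ∈ E ↔ S x = .A ∨ S x = .B := by
  constructor
  · intro hx
    obtain ⟨c, hc, hxc⟩ := hP.exists_inner x hx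
    rcases h.cases hP hx hc hxc with h1 | h1
    · exact Or.inl h1.1
    · exact Or.inr h1.1
  · intro hS
    by_contra hx
    obtain ⟨e, he, hxe⟩ := hP.exists_end x hx
    rcases h.cases hP he hx hxe.symm with h1 | h1 <;> simp [h1.2] at hS

theorem Labeled.attach_two (h : Labeled G S E) (hv : v ∈ E) :
    Labeled (attachPath G v 2) (Sum.elim S ![Status.A, .C]) (extend E {0}) := by
  refine ⟨?_, ?_⟩
  · rintro (e | i) he (c | j) hc hec hd
    · simp only [inl_mem_extend] at he hc
      exact h.leaf e he c hc hec fun d hdE hcd => hd (.inl d) (by simpa using hdE) hcd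
    · simp only [inr_mem_extend, Set.mem_singleton_iff, attachPath_inl_inr] at *
      omega
    · simp only [inl_mem_extend, attachPath_inr_inl] at *
      exact absurd hv (hec.1 ▸ hc)
    · simp only [inr_mem_extend, Set.mem_singleton_iff] at he hc
      have : j = 1 := by omega
      subst he this
      exact ⟨rfl, rfl⟩
  · rintro (e | i) he (e' | i') he' (c | j) (d | l) hc hd h1 h2 h3 <;>
      simp only [inl_mem_extend, inr_mem_extend, Set.mem_singleton_iff, attachPath_inl_inl,
        attachPath_inl_inr, attachPath_inr_inl, attachPath_inr_inr, Sum.elim_inl] at *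
    · exact h.link e he e' he' c d hc hd h1 h2 h3
    all_goals grind

/-- The two-vertex piece ending at `v` grows into one with statuses A, C, D, B; the last two new
vertices form a new piece with statuses A, C. -/
theorem Labeled.attach_four (h : Labeled G S E) (hP : Pieces G E) (hv : IsLeaf G v) :
    Labeled (attachPath G v 4) (Sum.elim S ![Status.D, .B, .A, .C]) (extend E {1, 2}) := by
  obtain ⟨hvE, hvd⟩ := hP.isLeaf_iff.1 hv
  have hlab : ∀ e ∈ E, G.Adj e v → S e = .A ∧ S v = .C :=
    fun e he hev => h.leaf e he v hvE hev hvd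
  refine ⟨?_, ?_⟩
  · rintro (e | i) he (c | j) hc hec hd
    · simp only [inl_mem_extend] at he hc
      exact h.leaf e he c hc hec fun d hdE hcd => hd (.inl d) (by simpa using hdE) hcd
    · simp only [inl_mem_extend, attachPath_inl_inr] at *
      exact absurd he (hec.1 ▸ hvE)
    · simp only [inr_mem_extend, Set.mem_insert_iff, Set.mem_singleton_iff,
        attachPath_inr_inl] at *
      omega
    · simp only [inr_mem_extend, Set.mem_insert_iff, Set.mem_singleton_iff,
        attachPath_inr_inr] at he hc hec
      have hj : j ≠ 0 := by
        rintro rfl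
        exact hd (.inl v) (by simpa using hvE) (by simp)
      obtain rfl : j = 3 := by omega
      obtain rfl : i = 2 := by omega
      exact ⟨rfl, rfl⟩
  · rintro (e | i) he (e' | i') he' (c | j) (d | l) hc hd h1 h2 h3 <;>
      simp only [inl_mem_extend, inr_mem_extend, Set.mem_singleton_iff, Set.mem_insert_iff,
        attachPath_inl_inl, attachPath_inl_inr, attachPath_inr_inl, attachPath_inr_inr,
        Sum.elim_inl, Sum.elim_inr] at *
    · exact h.link e he e' he' c d hc hd h1 h2 h3
    · exact absurd he' (h3.1 ▸ hvE)
    · exact absurd he (h1.1 ▸ hvE)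
    · exact absurd he (h1.1 ▸ hvE)
    · omega
    · left
      obtain ⟨rfl, h0⟩ := h2
      obtain rfl : l = 0 := by omega
      obtain rfl : i' = 1 := by omega
      exact ⟨(hlab e he h1).1, (hlab e he h1).2, rfl, rfl⟩
    · exact absurd he (h1.1 ▸ hvE)
    · exact absurd he (h1.1 ▸ hvE)
    · omega
    · omega
    · right
      obtain ⟨rfl, h0⟩ := h2
      obtain rfl : j = 0 := by omega
      obtain rfl : i = 1 := by omega
      exact ⟨rfl, rfl, (hlab e' he' h3.symm).2, (hlab e' he' h3.symm).1⟩
    · exact absurd he' (h3.1 ▸ hvE)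
    · omega
    · omega
    · omega
    · omega

theorem SmallEnd.inl {k : ℕ} {F : Set (Fin k)} {a : V} (h : SmallEnd G E a) (ha : a ≠ v) :
    SmallEnd (attachPath G v k) (extend E F) (.inl a) := by
  rintro (x | i) hx (y | j) hy h1 h2
  · exact congrArg _ (h x (by simpa using hx) y (by simpa using hy) h1 h2)
  · exact absurd h2.1 ha
  · exact absurd h1.1 ha
  · exact absurd h1.1 ha

/-- The end `v` gains an end neighbour and may stop being small, so its piece must be kept critical
by the small far end `e`. No other old end changes. -/
theorem Tight.attach_two (h : Tight G E) {c d e : V} (hv : v ∈ E) (hc : c ∉ E) (hd : d ∉ E)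
    (he : e ∈ E) (hvc : G.Adj v c) (hcd : G.Adj c d) (hde : G.Adj d e) (hs : SmallEnd G E e) :
    Tight (attachPath G v 2) (extend E {0}) := by
  have hP := h.toPieces
  have hev : e ≠ v := by
    rintro rfl
    exact hcd.ne (hP.inner_unique e he c d hc hd hvc hde.symm)
  refine ⟨hP.attach_two hv, ?_, ?_⟩
  · rintro (e₁ | i) he₁ (c₁ | j) hc₁ hec hd₁
    · simp only [inl_mem_extend] at he₁ hc₁
      have hne : e₁ ≠ v := by
        rintro rfl
        obtain rfl := hP.inner_unique e₁ hv c₁ c hc₁ hc hec hvc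
        exact hd₁ (.inl d) (by simpa using hd) hcd
      exact (h.small_of_leaf e₁ he₁ c₁ hc₁ hec fun d' hd' hcd' =>
        hd₁ (.inl d') (by simpa using hd') hcd').inl hne
    · simp only [inr_mem_extend, Set.mem_singleton_iff, attachPath_inl_inr] at *
      omega
    · simp only [inl_mem_extend, attachPath_inr_inl] at *
      exact absurd hv (hec.1 ▸ hc₁)
    · rintro (x | a) hx (y | b) hy h1 h2 <;>
        simp only [inr_mem_extend, Set.mem_singleton_iff,
          attachPath_inr_inl, attachPath_inr_inr] at *
      · rw [h1.1, h2.1]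
      all_goals omega
  · rintro (e₁ | i) he₁ (e₂ | i') he₂ (c₁ | j) (d₁ | l) hc₁ hd₁ h1 h2 h3 <;>
      simp only [inl_mem_extend, inr_mem_extend, Set.mem_singleton_iff, attachPath_inl_inl,
        attachPath_inl_inr, attachPath_inr_inl, attachPath_inr_inr] at *
    · by_cases h4 : e₁ = v
      · right
        subst h4
        obtain rfl := hP.inner_unique e₁ hv c₁ c hc₁ hc h1 hvc
        obtain rfl := hP.link_unique c₁ d₁ d hc₁ hd₁ hd h2 hcd
        obtain rfl := hP.end_unique d₁ hd e₂ he₂ e he h3 hde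
        exact hs.inl hev
      · by_cases h5 : e₂ = v
        · left
          subst h5
          obtain rfl := hP.inner_unique e₂ hv d₁ c hd₁ hc h3.symm hvc
          obtain rfl := hP.link_unique d₁ c₁ d hd₁ hc₁ hd h2.symm hcd
          obtain rfl := hP.end_unique c₁ hd e₁ he₁ e he h1.symm hde
          exact hs.inl hev
        · exact (h.small_of_link e₁ he₁ e₂ he₂ c₁ d₁ hc₁ hd₁ h1 h2 h3).imp
            (fun h => h.inl h4) (fun h => h.inl h5)
    all_goals grind

/-- The two new ends have only each other as end neighbours, hence are small; old ends gain no
neighbours because `v` is inner. -/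
theorem Tight.attach_four (h : Tight G E) (hv : IsLeaf G v) :
    Tight (attachPath G v 4) (extend E {1, 2}) := by
  have hP := h.toPieces
  obtain ⟨hvE, hvd⟩ := hP.isLeaf_iff.1 hv
  have hinl : ∀ e ∈ E, SmallEnd G E e →
      SmallEnd (attachPath G v 4) (extend E {1, 2}) (.inl e) :=
    fun e he hs => hs.inl fun hc => hvE (hc ▸ he)
  have hinr : ∀ i : Fin 4, Sum.inr i ∈ extend E {1, 2} →
      SmallEnd (attachPath G v 4) (extend E {1, 2}) (.inr i) := by
    rintro i hi (x | a) hx (y | b) hy h1 h2 <;>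
      simp only [inr_mem_extend, Set.mem_singleton_iff, Set.mem_insert_iff,
        attachPath_inr_inl, attachPath_inr_inr] at *
    · rw [h1.1, h2.1]
    · omega
    · omega
    · congr 1
      omega
  refine ⟨hP.attach_four hv, ?_, ?_⟩
  · rintro (e | i) he (c | j) hc hec hd
    · simp only [inl_mem_extend] at he hc
      exact hinl e he (h.small_of_leaf e he c hc hec fun d' hd' hcd' =>
        hd (.inl d') (by simpa using hd') hcd')
    · simp only [inl_mem_extend, attachPath_inl_inr] at *
      exact absurd he (hec.1 ▸ hvE)
    · exact hinr i he
    · exact hinr i he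
  · rintro (e | i) he (e' | i') he' c d hc hd h1 h2 h3
    · simp only [inl_mem_extend] at he he'
      have hne : ∀ x ∈ E, x ≠ v := fun x hx hxv => hvE (hxv ▸ hx)
      rcases c with c | j
      swap
      · exact absurd h1.1 (hne e he)
      rcases d with d | j
      swap
      · exact absurd h3.1 (hne e' he')
      exact (h.small_of_link e he e' he' c d (by simpa using hc) (by simpa using hd) h1 h2 h3).imp
        (hinl e he) (hinl e' he')
    · exact Or.inr (hinr i' he')
    · exact Or.inl (hinr i he)
    · exact Or.inl (hinr i he)

theorem Pieces.smallEnd_of_deg_eq_two (hP : Pieces G E) {e : V} (he : e ∈ E)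
    (hd : deg G e = 2) : SmallEnd G E e := by
  obtain ⟨x, y, -, hxy⟩ := deg_eq_two_iff.1 hd
  obtain ⟨c, hc, hec⟩ := hP.exists_inner e he
  intro a ha b hb hea heb
  have h1 := (hxy c).1 hec
  have h2 := (hxy a).1 hea
  have h3 := (hxy b).1 heb
  grind

end label

/-- The corresponding vertex of degree two is the far end of the piece of `v`. One of its two
neighbours is inner, so it is small, as `Tight.attach_two` needs. -/
theorem Generated.exists_tight {V : Type u} {G : SimpleGraph V} {S : V → Status} {P : Set V}
    (h : Generated G S P) : ∃ E, Tight G E ∧ Labeled G S E := by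
  induction h with
  | base G e =>
    exact ⟨_, tight_pathGraph_four.iso e, labeled_pathGraph_four.iso e⟩
  | op2 v _ hv hw ih =>
    obtain ⟨E, hE, hL⟩ := ih
    obtain ⟨w, ⟨-, f, rfl, hfv, h0, h1, h2⟩, hd⟩ := hw
    have hm := fun {x} => hL.mem_iff hE.toPieces (x := x)
    have hvE := hm.2 (Or.inr hv)
    have h2E : f 2 ∉ E := by rw [hm, h2]; simp
    have h1E : f 1 ∉ E := by rw [hm, h1]; simp
    have h0E : f 0 ∈ E := hm.2 (Or.inl h0)
    refine ⟨_, hE.attach_two hvE h2E h1E h0E ?_ ?_ ?_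
      (hE.toPieces.smallEnd_of_deg_eq_two h0E hd), hL.attach_two hvE⟩
    · rw [← hfv, f.map_adj_iff, SimpleGraph.pathGraph_adj]; decide
    · rw [f.map_adj_iff, SimpleGraph.pathGraph_adj]; decide
    · rw [f.map_adj_iff, SimpleGraph.pathGraph_adj]; decide
  | op3 v _ hv hd ih =>
    obtain ⟨E, hE, hL⟩ := ih
    exact ⟨_, hE.attach_four hd, hL.attach_four hE.toPieces hd⟩
  | op4 v _ hvP hv hw ih =>
    obtain ⟨E, hE, hL⟩ := ih
    obtain ⟨w, ⟨-, -, -, f, hfv, rfl, h1, h2, h3⟩, hd⟩ := hw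
    have hm := fun {x} => hL.mem_iff hE.toPieces (x := x)
    have hvE := hm.2 (Or.inl hv)
    have h2E : f 2 ∉ E := by rw [hm, h2]; simp
    have h1E : f 1 ∉ E := by rw [hm, h1]; simp
    have h3E : f 3 ∈ E := hm.2 (Or.inr h3)
    refine ⟨_, hE.attach_two hvE h1E h2E h3E ?_ ?_ ?_
      (hE.toPieces.smallEnd_of_deg_eq_two h3E hd), hL.attach_two hvE⟩
    · rw [← hfv, f.map_adj_iff, SimpleGraph.pathGraph_adj]; decide
    · rw [f.map_adj_iff, SimpleGraph.pathGraph_adj]; decide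
    · rw [f.map_adj_iff, SimpleGraph.pathGraph_adj]; decide
  | iso e _ ih =>
    obtain ⟨E, hE, hL⟩ := ih
    exact ⟨_, hE.iso e, hL.iso e⟩

/-! ### Generating the trees with a tight decomposition -/

/-- An injective homomorphism from a connected graph to an acyclic graph is an embedding. -/
theorem exists_embedding {V : Type u} {W : Type w} {T : SimpleGraph V} {H : SimpleGraph W}
    (hT : T.IsAcyclic) (hH : H.Connected) (f : W → V) (hf : Function.Injective f)
    (hadj : ∀ a b, H.Adj a b → T.Adj (f a) (f b)) : ∃ ψ : H ↪g T, ∀ x, ψ x = f x := by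
  refine ⟨⟨⟨f, hf⟩, ?_⟩, fun _ => rfl⟩
  intro a b
  refine ⟨fun hab => ?_, hadj a b⟩
  change T.Adj (f a) (f b) at hab
  classical
  -- The image of a path from `a` to `b` is the unique path of `T` between the images, hence the
  -- single edge `hab`; so it has length one.
  let φ : H →g T := ⟨f, fun {a b} h => hadj a b h⟩
  obtain ⟨p, hp⟩ := hH.exists_isPath a b
  have hp' : (p.map φ).IsPath := hp.map hf
  have h1 := congrArg SimpleGraph.Walk.length (Subtype.mk.inj
    ((hT.subsingleton_path _ _).elim ⟨_, hp'⟩ (SimpleGraph.Path.singleton hab)))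
  rw [SimpleGraph.Walk.length_map] at h1
  exact SimpleGraph.Walk.adj_of_length_eq_one h1

theorem exists_embedding_attach {V W : Type u} {T : SimpleGraph V} {G : SimpleGraph W}
    (hT : T.IsAcyclic) (hG : G.Connected) (ι : G ↪g T) {v : W} {k : ℕ} (f : Fin k → V)
    (hf : Function.Injective f) (hr : ∀ a i, ι a ≠ f i)
    (h0 : ∀ i, i.val = 0 → T.Adj (ι v) (f i))
    (hs : ∀ i j, i.val + 1 = j.val → T.Adj (f i) (f j)) :
    ∃ ψ : attachPath G v k ↪g T, ∀ x, ψ x = Sum.elim ι f x := by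
  refine exists_embedding hT (attachPath_connected hG v k) (Sum.elim ι f) ?_ ?_
  · rintro (a | i) (b | j) hab
    · exact congrArg _ (ι.injective hab)
    · exact absurd hab (hr a j)
    · exact absurd hab.symm (hr b i)
    · exact congrArg _ (hf hab)
  · rintro (a | i) (b | j) hab
    · exact ι.map_adj_iff.2 hab
    · obtain ⟨rfl, hj⟩ := hab
      exact h0 j hj
    · obtain ⟨rfl, hi⟩ := hab
      exact (h0 i hi).symm
    · rcases attachPath_inr_inr.1 hab with h | h
      · exact hs i j h
      · exact (hs j i h).symm

/-- A walk along four vertices of a tree whose second and third steps do not go back is an induced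
path. -/
theorem exists_pathGraph_four {V : Type u} {T : SimpleGraph V} (hT : T.IsAcyclic) (f : Fin 4 → V)
    (hf : Function.Injective f) (h0 : T.Adj (f 0) (f 1)) (h1 : T.Adj (f 1) (f 2))
    (h2 : T.Adj (f 2) (f 3)) : ∃ ψ : SimpleGraph.pathGraph 4 ↪g T, ∀ x, ψ x = f x := by
  refine exists_embedding hT (SimpleGraph.pathGraph_connected 3) f hf ?_
  have key : ∀ i j : Fin 4, i.val + 1 = j.val → T.Adj (f i) (f j) := by
    intro i j hij
    have : (i = 0 ∧ j = 1) ∨ (i = 1 ∧ j = 2) ∨ (i = 2 ∧ j = 3) := by omega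
    rcases this with ⟨rfl, rfl⟩ | ⟨rfl, rfl⟩ | ⟨rfl, rfl⟩
    exacts [h0, h1, h2]
  intro a b hab
  rcases SimpleGraph.pathGraph_adj.1 hab with h | h
  · exact key a b h
  · exact (key b a h).symm

section tight

variable {V : Type u} {T : SimpleGraph V} {E : Set V}

/-- A tree with a tight decomposition has two adjacent small ends. -/
theorem Tight.exists_base [Finite V] (hT : T.IsTree) (h : Tight T E) :
    ∃ x ∈ E, ∃ y ∈ E, T.Adj x y ∧ SmallEnd T E x ∧ SmallEnd T E y := by
  have hP := h.toPieces
  by_contra hno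
  push Not at hno
  obtain ⟨e₀, he₀⟩ : ∃ e, e ∈ E := by
    obtain ⟨v⟩ := hT.connected.nonempty
    by_cases hv : v ∈ E
    · exact ⟨v, hv⟩
    · obtain ⟨e, he, -⟩ := hP.exists_end v hv
      exact ⟨e, he⟩
  obtain ⟨r, hr, hrs⟩ : ∃ r ∈ E, ¬ SmallEnd T E r := by
    obtain ⟨y, hy, hey⟩ := hP.exists_adj_end e₀ he₀
    by_cases hs : SmallEnd T E e₀
    · exact ⟨y, hy, hno e₀ he₀ y hy hey hs⟩
    · exact ⟨e₀, he₀, hs⟩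
  -- The piece of a large end has a small far end by tightness, and an end next to that one is
  -- large, since adjacent small ends are excluded. Each large end thus yields another farther from
  -- `r`, without limit.
  have key : ∀ m : ℕ, ∃ z ∈ E, ¬ SmallEnd T E z ∧ m ≤ T.dist r z ∧
      ∃ c, c ∉ E ∧ T.Adj z c ∧ T.dist r c = T.dist r z + 1 := by
    intro m
    induction m with
    | zero =>
      obtain ⟨c, hc, hrc⟩ := hP.exists_inner r hr
      exact ⟨r, hr, hrs, Nat.zero_le _, c, hc, hrc, by
        rw [SimpleGraph.dist_self, SimpleGraph.dist_eq_one_iff_adj.2 hrc]⟩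
    | succ m ih =>
      obtain ⟨z, hz, hzs, hm, c, hc, hzc, hcd⟩ := ih
      obtain ⟨d, hd, hcd'⟩ : ∃ d, d ∉ E ∧ T.Adj c d := by
        by_contra hno'
        push Not at hno'
        exact hzs (h.small_of_leaf z hz c hc hzc hno')
      obtain ⟨e, he, hde⟩ := hP.exists_end d hd
      have hes : SmallEnd T E e :=
        (h.small_of_link z hz e he c d hc hd hzc hcd' hde).resolve_left hzs
      obtain ⟨y, hy, hey⟩ := hP.exists_adj_end e he
      obtain ⟨c', hc', hyc'⟩ := hP.exists_inner y hy
      have h1 := dist_child hT r hzc.symm hcd hcd' (fun hdz => hd (hdz ▸ hz))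
      have h2 := dist_child hT r hcd'.symm h1 hde (fun hec => hc (hec ▸ he))
      have h3 := dist_child hT r hde.symm h2 hey (fun hyd => hd (hyd ▸ hy))
      have h4 := dist_child hT r hey.symm h3 hyc' (fun hce => hc' (hce ▸ he))
      exact ⟨y, hy, hno e he y hy hey hes, by omega, c', hc', hyc', h4⟩
  obtain ⟨M, hM⟩ := (Set.finite_range (T.dist r)).bddAbove
  obtain ⟨z, -, -, hz, -⟩ := key (M + 1)
  have := hM ⟨z, rfl⟩
  omega

/-- A generated tree embedded in `T` compatibly with the decomposition of `T`. -/
structure Grown (T : SimpleGraph V) (E : Set V) {W : Type u} (G : SimpleGraph W)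
    (S : W → Status) (P : Set W) (ι : G ↪g T) : Prop where
  generated : Generated G S P
  connected : G.Connected
  pieces : Pieces G (ι ⁻¹' E)
  labeled : Labeled G S (ι ⁻¹' E)
  -- Keeps large ends off the basic path, as `op4` requires.
  small : ∀ a ∈ P, ι a ∈ E → SmallEnd T E (ι a)

/-- The initial path consists of two adjacent small ends and their inner neighbours. -/
theorem exists_grown [Finite V] (hT : T.IsTree) (h : Tight T E) :
    ∃ (W : Type u) (G : SimpleGraph W) (S : W → Status) (P : Set W) (ι : G ↪g T),
      Grown T E G S P ι := by
  have hP := h.toPieces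
  obtain ⟨x, hx, y, hy, hxy, hxs, hys⟩ := h.exists_base hT
  obtain ⟨c, hc, hxc⟩ := hP.exists_inner x hx
  obtain ⟨d, hd, hyd⟩ := hP.exists_inner y hy
  have hcd : c ≠ d := by
    rintro rfl
    exact hxy.ne (hP.end_unique c hc x hx y hy hxc.symm hyd.symm)
  have hcy : c ≠ y := fun hcy => hc (hcy ▸ hy)
  have hdx : d ≠ x := fun hdx => hd (hdx ▸ hx)
  obtain ⟨ψ, hψ⟩ := exists_pathGraph_four hT.isAcyclic ![c, x, y, d] (by
    intro i j hij
    have h1 := hxc.ne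
    have h2 := hyd.ne
    have h3 := hxy.ne
    fin_cases i <;> fin_cases j <;> simp_all) hxc.symm hxy hyd
  -- Lifted because `Generated` stays within one universe.
  let G : SimpleGraph (ULift.{u} (Fin 4)) := (SimpleGraph.pathGraph 4).comap ULift.down
  let e : SimpleGraph.pathGraph 4 ≃g G := ⟨Equiv.ulift.symm, Iff.rfl⟩
  let ι : G ↪g T := e.symm.toEmbedding.trans ψ
  have hE : ι ⁻¹' E = e.symm ⁻¹' {1, 2} := by
    ext ⟨i⟩
    change ψ i ∈ E ↔ i ∈ ({1, 2} : Set (Fin 4))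
    rw [hψ]
    fin_cases i <;> simp [hx, hy, hc, hd]
  refine ⟨_, G, _, _, ι, ⟨Generated.base G e, ?_, ?_, ?_, ?_⟩⟩
  · exact e.connected_iff.1 (SimpleGraph.pathGraph_connected 3)
  · rw [hE]
    exact tight_pathGraph_four.toPieces.iso e
  · rw [hE]
    exact labeled_pathGraph_four.iso e
  · rintro ⟨i⟩ - hi
    change ψ i ∈ E at hi
    change SmallEnd T E (ψ i)
    rw [hψ] at hi ⊢
    fin_cases i
    · exact absurd hi hc
    · exact hxs
    · exact hys
    · exact absurd hi hd

/-! ### Enlarging a generated subtree -/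

variable {W : Type u} {G : SimpleGraph W} {S : W → Status} {P : Set W} {ι : G ↪g T}

theorem Grown.extend_two (hT : T.IsTree) (hTE : Pieces T E) (hgr : Grown T E G S P ι) {a : W}
    {x : V} (ha : ι a ∈ E) (hx : x ∈ E) (hax : T.Adj (ι a) x) (hxι : x ∉ Set.range ι)
    (hgen : Generated (attachPath G a 2) (Sum.elim S ![Status.A, .C]) (Sum.inl '' P)) :
    ∃ ψ : attachPath G a 2 ↪g T,
      Grown T E (attachPath G a 2) (Sum.elim S ![Status.A, .C]) (Sum.inl '' P) ψ := by
  obtain ⟨c, hc, hxc⟩ := hTE.exists_inner x hx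
  have hcι : c ∉ Set.range ι := by
    rintro ⟨b, rfl⟩
    obtain ⟨e, he, hbe⟩ := hgr.pieces.exists_end b hc
    exact hxι ⟨e, hTE.end_unique _ hc _ he _ hx (ι.map_adj_iff.2 hbe) hxc.symm⟩
  obtain ⟨ψ, hψ⟩ := exists_embedding_attach hT.isAcyclic hgr.connected ι (v := a) (k := 2) ![x, c]
    (by
      intro i j hij
      have := hxc.ne
      fin_cases i <;> fin_cases j <;> simp_all)
    (by
      intro b i hbi
      fin_cases i
      · exact hxι ⟨b, hbi⟩
      · exact hcι ⟨b, hbi⟩)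
    (by
      intro i hi
      obtain rfl : i = 0 := by omega
      exact hax)
    (by
      intro i j hij
      obtain rfl : i = 0 := by omega
      obtain rfl : j = 1 := by omega
      exact hxc)
  have hE : ψ ⁻¹' E = extend (ι ⁻¹' E) {0} := by
    ext (b | i)
    · simp [hψ]
    · fin_cases i <;> simp [hψ, hx, hc]
  refine ⟨ψ, hgen, attachPath_connected hgr.connected a 2, ?_, ?_, ?_⟩
  · rw [hE]
    exact hgr.pieces.attach_two ha
  · rw [hE]
    exact hgr.labeled.attach_two ha
  · rintro _ ⟨b, hb, rfl⟩ hbE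
    rw [hψ] at hbE ⊢
    exact hgr.small b hb hbE

theorem Grown.extend_four (hT : T.IsTree) (hTE : Pieces T E) (hgr : Grown T E G S P ι) {a : W}
    {d : V} (ha : ι a ∉ E) (hd : d ∉ E) (had : T.Adj (ι a) d) (hdι : d ∉ Set.range ι) :
    ∃ ψ : attachPath G a 4 ↪g T,
      Grown T E (attachPath G a 4) (Sum.elim S ![Status.D, .B, .A, .C]) (Sum.inl '' P) ψ := by
  have hP := hgr.pieces
  have hnone : ∀ b, ι b ∉ E → ¬ G.Adj a b := by
    intro b hb hab
    exact hdι ⟨b, hTE.link_unique _ _ _ ha hb hd (ι.map_adj_iff.2 hab) had⟩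
  have hleaf : IsLeaf G a := hP.isLeaf_iff.2 ⟨ha, hnone⟩
  obtain ⟨m, hm, ham⟩ := hP.exists_end a ha
  have hSa : S a = .C := (hgr.labeled.leaf m hm a ha ham.symm hnone).2
  obtain ⟨e, he, hde⟩ := hTE.exists_end d hd
  obtain ⟨x, hx, hex⟩ := hTE.exists_adj_end e he
  obtain ⟨c, hc, hxc⟩ := hTE.exists_inner x hx
  have heι : e ∉ Set.range ι := by
    rintro ⟨b, rfl⟩
    obtain ⟨c', hc', hbc⟩ := hP.exists_inner b he
    exact hdι ⟨c', hTE.inner_unique _ he _ _ hc' hd (ι.map_adj_iff.2 hbc) hde.symm⟩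
  have hxι : x ∉ Set.range ι := by
    rintro ⟨b, rfl⟩
    -- If `x` were already covered, the edge `e x` would close a cycle: the subtree with `d`, `e`
    -- attached is induced, so its far vertex has no neighbour in `G`.
    obtain ⟨φ, hφ⟩ := exists_embedding_attach hT.isAcyclic hgr.connected ι (v := a) (k := 2) ![d, e]
      (by
        intro i j hij
        have := hde.ne
        fin_cases i <;> fin_cases j <;> simp_all)
      (by
        intro b i hbi
        fin_cases i
        · exact hdι ⟨b, hbi⟩
        · exact heι ⟨b, hbi⟩)
      (by
        intro i hi
        obtain rfl : i = 0 := by omega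
        exact had)
      (by
        intro i j hij
        obtain rfl : i = 0 := by omega
        obtain rfl : j = 1 := by omega
        exact hde)
    have h1 : T.Adj (φ (.inr 1)) (φ (.inl b)) := by
      rw [hφ, hφ]
      exact hex
    rw [φ.map_adj_iff, attachPath_inr_inl] at h1
    simp at h1
  have hcι : c ∉ Set.range ι := by
    rintro ⟨b, rfl⟩
    obtain ⟨e', he', hbe⟩ := hP.exists_end b hc
    exact hxι ⟨e', hTE.end_unique _ hc _ he' _ hx (ι.map_adj_iff.2 hbe) hxc.symm⟩
  have hcd : d ≠ c := by
    rintro rfl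
    exact hex.ne (hTE.end_unique d hd e he x hx hde hxc.symm)
  have hdx : d ≠ x := fun hdx => hd (hdx ▸ hx)
  have hec : e ≠ c := fun hec => hc (hec ▸ he)
  obtain ⟨ψ, hψ⟩ := exists_embedding_attach hT.isAcyclic hgr.connected ι (v := a) (k := 4)
    ![d, e, x, c]
    (by
      intro i j hij
      have h1 := hde.ne
      have h2 := hex.ne
      have h3 := hxc.ne
      fin_cases i <;> fin_cases j <;> simp_all)
    (by
      intro b i hbi
      fin_cases i
      · exact hdι ⟨b, hbi⟩
      · exact heι ⟨b, hbi⟩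
      · exact hxι ⟨b, hbi⟩
      · exact hcι ⟨b, hbi⟩)
    (by
      intro i hi
      obtain rfl : i = 0 := by omega
      exact had)
    (by
      intro i j hij
      have : (i = 0 ∧ j = 1) ∨ (i = 1 ∧ j = 2) ∨ (i = 2 ∧ j = 3) := by omega
      rcases this with ⟨rfl, rfl⟩ | ⟨rfl, rfl⟩ | ⟨rfl, rfl⟩
      exacts [hde, hex, hxc])
  have hE : ψ ⁻¹' E = extend (ι ⁻¹' E) {1, 2} := by
    ext (b | i)
    · simp [hψ]
    · fin_cases i <;> simp [hψ, hd, he, hx, hc]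
  refine ⟨ψ, Generated.op3 a hgr.generated hSa hleaf, attachPath_connected hgr.connected a 4,
    ?_, ?_, ?_⟩
  · rw [hE]
    exact hP.attach_four hleaf
  · rw [hE]
    exact hgr.labeled.attach_four hP hleaf
  · rintro _ ⟨b, hb, rfl⟩ hbE
    rw [hψ] at hbE ⊢
    exact hgr.small b hb hbE

/-- A generated proper subtree can be enlarged. -/
theorem Grown.exists_larger (hT : T.IsTree) (h : Tight T E) (hgr : Grown T E G S P ι)
    (hsurj : ¬ Function.Surjective ι) :
    ∃ (k : ℕ) (_ : 0 < k) (a : W) (S' : W ⊕ Fin k → Status) (P' : Set (W ⊕ Fin k))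
      (ψ : attachPath G a k ↪g T), Grown T E (attachPath G a k) S' P' ψ := by
  have hTE := h.toPieces
  have hP := hgr.pieces
  obtain ⟨a, x, hax, hx⟩ : ∃ a x, T.Adj (ι a) x ∧ x ∉ Set.range ι := by
    unfold Function.Surjective at hsurj
    push Not at hsurj
    obtain ⟨y, hy⟩ := hsurj
    obtain ⟨b⟩ := hgr.connected.nonempty
    obtain ⟨p⟩ := hT.connected.preconnected (ι b) y
    obtain ⟨d, -, ⟨a, ha⟩, hd⟩ := p.exists_boundary_dart (Set.range ι) ⟨b, rfl⟩
      (fun ⟨a, ha⟩ => hy a ha)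
    exact ⟨a, d.snd, ha ▸ d.adj, hd⟩
  by_cases ha : ι a ∈ E
  swap
  -- An inner vertex has its unique end inside the subtree already, so the edge leaving it is a
  -- link.
  · have hxE : x ∉ E := by
      intro hxE
      obtain ⟨m, hm, ham⟩ := hP.exists_end a ha
      exact hx ⟨m, hTE.end_unique _ ha _ hm _ hxE (ι.map_adj_iff.2 ham) hax⟩
    obtain ⟨ψ, hψ⟩ := hgr.extend_four hT hTE ha hxE hax hx
    exact ⟨4, by omega, a, _, _, ψ, hψ⟩
  obtain ⟨c, hc, hac⟩ := hP.exists_inner a ha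
  have hxE : x ∈ E := by
    by_contra hxE
    exact hx ⟨c, hTE.inner_unique _ ha _ _ hc hxE (ι.map_adj_iff.2 hac) hax⟩
  -- The end `a` has one end neighbour inside the subtree and another, `x`, outside. Being large, it
  -- lies in a linked piece with small far end.
  have hbig : ¬ SmallEnd T E (ι a) := by
    intro hs
    obtain ⟨y, hy, hay⟩ := hP.exists_adj_end a ha
    exact hx ⟨y, hs _ hy _ hxE (ι.map_adj_iff.2 hay) hax⟩
  obtain ⟨d, hd, hcd⟩ : ∃ d, d ∉ E ∧ T.Adj (ι c) d := by
    by_contra hno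
    push Not at hno
    exact hbig (h.small_of_leaf _ ha _ hc (ι.map_adj_iff.2 hac) hno)
  by_cases hdι : d ∈ Set.range ι
  swap
  · obtain ⟨ψ, hψ⟩ := hgr.extend_four hT hTE hc hd hcd hdι
    exact ⟨4, by omega, c, _, _, ψ, hψ⟩
  obtain ⟨d, rfl⟩ := hdι
  rw [ι.map_adj_iff] at hcd
  obtain ⟨e, he, hde⟩ := hP.exists_end d hd
  have hes : SmallEnd T E (ι e) :=
    (h.small_of_link _ ha _ he _ _ hc hd (ι.map_adj_iff.2 hac) (ι.map_adj_iff.2 hcd)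
      (ι.map_adj_iff.2 hde)).resolve_left hbig
  -- A small end has exactly its inner neighbour and one end: this is the corresponding vertex of
  -- degree two.
  have hdeg : deg G e = 2 := by
    obtain ⟨y, hy, hey⟩ := hP.exists_adj_end e he
    refine deg_eq_two_iff.2 ⟨d, y, fun hdy => hd (hdy ▸ hy), fun z => ⟨fun hz => ?_, ?_⟩⟩
    · by_cases hzE : ι z ∈ E
      · exact Or.inr (ι.injective (hes _ hzE _ hy (ι.map_adj_iff.2 hz) (ι.map_adj_iff.2 hey)))
      · exact Or.inl (hP.inner_unique e he z d hzE hd hz hde.symm)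
    · rintro (rfl | rfl)
      · exact hde.symm
      · exact hey
  have hGa : G.IsAcyclic := hT.isAcyclic.embedding ι
  have hea : a ≠ e := by
    rintro rfl
    exact hcd.ne (hP.inner_unique a ha c d hc hd hac hde.symm)
  have had : a ≠ d := fun had => hd (had ▸ ha)
  have hce : c ≠ e := fun hce => hc (hce ▸ he)
  suffices hgen : Generated (attachPath G a 2) (Sum.elim S ![Status.A, .C]) (Sum.inl '' P) by
    obtain ⟨ψ, hψ⟩ := hgr.extend_two hT hTE ha hxE hax hx hgen
    exact ⟨2, by omega, a, _, _, ψ, hψ⟩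
  have h1 := hac.ne
  have h2 := hcd.ne
  have h3 := hde.ne
  -- The status of `a` selects the operation: `op4` for A, and `op2` for B with the induced path
  -- read from `e`.
  rcases hgr.labeled.link a ha e he c d hc hd hac hcd hde with
    ⟨hSa, hSc, hSd, hSe⟩ | ⟨hSa, hSc, hSd, hSe⟩
  · have haP : a ∉ P := fun haP => hbig (hgr.small a haP ha)
    obtain ⟨φ, hφ⟩ := exists_pathGraph_four hGa ![a, c, d, e]
      (by intro i j hij; fin_cases i <;> fin_cases j <;> simp_all) hac hcd hde
    have hsup : ¬ IsSupport G a := by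
      rintro ⟨y, hay, hy⟩
      obtain ⟨hyE, hyd⟩ := hP.isLeaf_iff.1 hy
      obtain rfl := hP.inner_unique a ha y c hyE hc hay hac
      exact hyd d hd hcd
    refine Generated.op4 a hgr.generated haP hSa ⟨e, ⟨hsup, haP, hSa, φ, ?_, ?_, ?_, ?_, hSe⟩, hdeg⟩
    · exact hφ 0
    · exact hφ 3
    · rw [hφ]; exact hSc
    · rw [hφ]; exact hSd
  · obtain ⟨φ, hφ⟩ := exists_pathGraph_four hGa ![e, d, c, a]
      (by intro i j hij; fin_cases i <;> fin_cases j <;> simp_all) hde.symm hcd.symm hac.symm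
    refine Generated.op2 a hgr.generated hSa ⟨e, ⟨hSa, φ, ?_, ?_, hSe, ?_, ?_⟩, hdeg⟩
    · exact hφ 0
    · exact hφ 3
    · rw [hφ]; exact hSd
    · rw [hφ]; exact hSc

theorem Tight.exists_familyT2 [Finite V] (hT : T.IsTree) (h : Tight T E) :
    ∃ S : V → Status, FamilyT2 T S := by
  have key : ∀ (n : ℕ) (W : Type u) (G : SimpleGraph W) (S : W → Status) (P : Set W)
      (ι : G ↪g T), Grown T E G S P ι → Nat.card V ≤ Nat.card W + n →
      ∃ S : V → Status, FamilyT2 T S := by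
    intro n
    induction n with
    | zero =>
      intro W G S P ι hgr hcard
      have := Finite.of_injective ι ι.injective
      have hb : Function.Bijective ι := by
        rw [Nat.bijective_iff_injective_and_card]
        exact ⟨ι.injective, le_antisymm (Nat.card_le_card_of_injective ι ι.injective) hcard⟩
      let e : G ≃g T := ⟨Equiv.ofBijective ι hb, ι.map_rel_iff'⟩
      exact ⟨_, _, Generated.iso e hgr.generated⟩
    | succ n ih =>
      intro W G S P ι hgr hcard
      have := Finite.of_injective ι ι.injective
      by_cases hs : Function.Surjective ι
      · exact ih W G S P ι hgr (Nat.card_le_card_of_surjective ι hs |>.trans (by omega))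
      · obtain ⟨k, hk, a, S', P', ψ, hψ⟩ := hgr.exists_larger hT h hs
        exact ih _ _ S' P' ψ hψ (by rw [card_attach]; omega)
  obtain ⟨W, G, S, P, ι, hgr⟩ := exists_grown hT h
  exact key (Nat.card V) W G S P ι hgr (by omega)

end tight

end DisjDom

theorem theorem2p4 {V : Type*} [Fintype V] [Nontrivial V] (T : SimpleGraph V) (hT : T.IsTree) :
    (DisjDom.disjDomNumber T : ℚ) ≤
        ((Fintype.card V : ℚ) + DisjDom.numLeaves T + DisjDom.numSupports T) / 4 ∧
      ((DisjDom.disjDomNumber T : ℚ) =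
          ((Fintype.card V : ℚ) + DisjDom.numLeaves T + DisjDom.numSupports T) / 4 ↔
        ∃ S : V → DisjDom.Status, DisjDom.FamilyT2 T S) := by
  have hB := DisjDom.bound_of_isTree hT
  have hw : ((Fintype.card V : ℚ) + DisjDom.numLeaves T + DisjDom.numSupports T) =
      (DisjDom.weight T : ℚ) := by
    unfold DisjDom.weight
    rw [Nat.card_eq_fintype_card]
    push_cast
    ring
  rw [hw, le_div_iff₀ (by norm_num), eq_div_iff (by norm_num), mul_comm]
  refine ⟨by exact_mod_cast hB.1, ?_⟩
  have hcast : (4 * DisjDom.disjDomNumber T : ℚ) = DisjDom.weight T ↔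
      4 * DisjDom.disjDomNumber T = DisjDom.weight T := by norm_cast
  rw [hcast]
  constructor
  · intro heq
    obtain ⟨E, hE⟩ := hB.2 heq
    exact (hE.tight_of_eq hT heq).exists_familyT2 hT
  · rintro ⟨S, P, hgen⟩
    obtain ⟨E, hE, -⟩ := hgen.exists_tight
    obtain ⟨D, hD, hc⟩ := DisjDom.exists_dominating T
    have := hE.weight_le hD
    have := hB.1
    omega
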